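/- Let $E=(E^0,E^1,r,s)$ be a finite directed graph with no sources and no sinks, and let $n\ge 1$. Paths are composed from right to left ($ew$ walks along $w$ and then along the edge $e$, and needs $s(e)=r(w)$), $|w|$ is the length of $w$, vertices are the paths of length $0$, $E^*$ is the set of all finite paths and $E^{<n}$ the set of paths of length $<n$. Every $w\in E^*$ factors uniquely as $w=w(n)\,v_k\cdots v_1$ with $|v_i|=n$ and $|w(n)|<n$. Let $\mathcal H_E=\ell^2(E^*)$ with orthonormal basis $\{\xi_w\}$. Let $\mathcal A(n)$ be the $C^*$-algebra generated by the operators $T_e$, $e\in E^1$, of all $n$-periodic weighted shifts on $\mathcal H_E$, that is, $T_e\xi_w=\lambda(ew)\xi_{ew}$ (and $T_e\xi_w=0$ if $s(e)\ne r(w)$) with weights satisfying $\lambda(ew)=\lambda(e\,w(n))$. Let $\mathfrak K_E=\bigoplus_{x\in E^0}R_x\mathfrak K R_x$, where $\mathfrak K$ is the set of compact operators on $\mathcal H_E$ and $R_x$ is the projection onto $\overline{\operatorname{span}}\{\xi_w: s(w)=x\}$. Let $E(n)$ be the graph with vertex set $E^{<n}$ and edge set $\{(e,w)\in E^1\times E^{<n}: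 s(e)=r(w)\}$, where $s(e,w)=w$, and $r(e,w)=ew$ if $|w|<n-1$, $r(e,w)=r(e)$ if $|w|=n-1$. A Cuntz--Krieger family of a finite graph consists of mutually orthogonal projections $P_x$ (one for each vertex) and partial isometries $S_f$ (one for each edge) with $S_f^*S_g=0$ for $f\ne g$, $S_f^*S_f=P_{s(f)}$, and $\sum_{r(f)=x}S_fS_f^*=P_x$ whenever $r^{-1}(x)\neq\emptyset$; the graph algebra $\mathcal O(E(n))$ is the universal $C^*$-algebra generated by a Cuntz--Krieger family $\{p_w,s_{(e,w)}\}$ of $E(n)$. For $w\in E^{<n}$ let $Q_w$ be the projection onto $\overline{\operatorname{span}}\{\xi_{w'}: w'(n)=w\}$, for an edge $(e,w)$ of $E(n)$ let $T_{(e,w)}\xi_{w'}=\xi_{ew'}$ if $w'(n)=w$ and $T_{(e,w)}\xi_{w'}=0$ otherwise, and let $q$ be the quotient map of $\mathcal B(\mathcal H_E)$ onto the Calkin algebra $\mathcal B(\mathcal H_E)/\mathfrak K$. Then $P_w=q(Q_w)$, $S_{(e,w)}=q(T_{(e,w)})$ is a Cuntz--Krieger family of $E(n)$; $\mathfrak K_E$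 is contained in $\mathcal A(n)$; and there is a unique $*$-homomorphism $\pi$ from $\mathcal O(E(n))$ to the Calkin algebra with $\pi(p_w)=P_w$ and $\pi(s_{(e,w)})=S_{(e,w)}$. The map $\pi$ is injective with range $q(\mathcal A(n))$ and, identifying the class of $a\in\mathcal A(n)$ modulo $\mathfrak K_E$ with $q(a)$, it is a $*$-isomorphism of $\mathcal O(E(n))$ onto $\mathcal B(n)=\mathcal A(n)/\mathfrak K_E$. -/

import Mathlib

open scoped ENNReal lp

universe u

noncomputable section

/-! ## Directed graphs and Cuntz-Krieger families -/

/-- A directed graph `(E⁰, E¹, r, s)` with vertex set `V`, edge set `E`, source map `s` and range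
map `r` (loops and multiple edges are allowed). -/
structure DirectedGraph (V E : Type u) where
  s : E → V
  r : E → V

/-- Every vertex is the range of some edge. -/
def DirectedGraph.NoSources {V E : Type u} (G : DirectedGraph V E) : Prop :=
  ∀ x : V, ∃ e : E, G.r e = x

/-- Every vertex is the source of some edge. -/
def DirectedGraph.NoSinks {V E : Type u} (G : DirectedGraph V E) : Prop :=
  ∀ x : V, ∃ e : E, G.s e = x

/-- Cuntz-Krieger families `{P_x, S_e}` of a graph with finitely many edges, in a ring with
involution. (At a vertex `x` with `r⁻¹(x) = ∅` the inequality `∑_{r(e)=x} S_e S_e^* ≤ P_x` is void,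
so that only the equality at the remaining vertices has to be required.) -/
structure DirectedGraph.IsCKFamily {V E : Type u} [Finite E] (G : DirectedGraph V E)
    {A : Type*} [NonUnitalRing A] [StarRing A] (P : V → A) (S : E → A) : Prop where
  projection : ∀ x, IsStarProjection (P x)
  partialIsometry : ∀ e, S e * star (S e) * S e = S e
  orthogonal : ∀ x y, x ≠ y → P x * P y = 0
  star_mul_of_ne : ∀ e f, e ≠ f → star (S e) * S f = 0
  star_mul_self : ∀ e, star (S e) * S e = P (G.s e)
  sum_range : ∀ x, (∃ e, G.r e = x) → ∑ᶠ e ∈ {e | G.r e = x}, S e * star (S e) = P x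

/-! ## The universal algebra `O(G)` -/

/-- The C⋆-algebra generated by a set: the smallest closed ⋆-subalgebra containing it. -/
def cstarGenerated {A : Type*} [NonUnitalCStarAlgebra A] (X : Set A) :
    NonUnitalStarSubalgebra ℂ A :=
  (NonUnitalStarAlgebra.adjoin ℂ X).topologicalClosure

/-- A C⋆-algebra together with a Cuntz-Krieger `G`-family in it. -/
structure DirectedGraph.CKRep {V E : Type u} [Finite E] (G : DirectedGraph V E) where
  A : Type u
  [cstar : NonUnitalCStarAlgebra A]
  P : V → A
  S : E → A
  isCK : G.IsCKFamily P S

attribute [instance] DirectedGraph.CKRep.cstar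

namespace DirectedGraph

variable {V E : Type u}

/-- The `ℓ^∞`-product of all C⋆-algebras that carry a Cuntz-Krieger `G`-family. -/
abbrev CKProduct [Finite E] (G : DirectedGraph V E) : Type (u + 1) :=
  lp (fun ρ : G.CKRep => ρ.A) ∞

theorem IsCKFamily.norm_P_le [Finite E] {G : DirectedGraph V E} {A : Type*}
    [NonUnitalCStarAlgebra A] {P : V → A} {S : E → A} (h : G.IsCKFamily P S) (x : V) :
    ‖P x‖ ≤ 1 :=
  IsStarProjection.norm_le _ (h.projection x)

theorem IsCKFamily.norm_S_le [Finite E] {G : DirectedGraph V E} {A : Type*}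
    [NonUnitalCStarAlgebra A] {P : V → A} {S : E → A} (h : G.IsCKFamily P S) (e : E) :
    ‖S e‖ ≤ 1 := by
  have h1 : ‖S e‖ * ‖S e‖ ≤ 1 := by
    rw [← CStarRing.norm_star_mul_self, h.star_mul_self]
    exact h.norm_P_le _
  nlinarith [norm_nonneg (S e)]

/-- The tuple of all vertex projections over the vertex `x`. -/
def prodP [Finite E] (G : DirectedGraph V E) (x : V) : G.CKProduct :=
  ⟨fun ρ => ρ.P x, memℓp_infty ⟨1, by rintro _ ⟨ρ, rfl⟩; exact ρ.isCK.norm_P_le x⟩⟩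

/-- The tuple of all partial isometries over the edge `e`. -/
def prodS [Finite E] (G : DirectedGraph V E) (e : E) : G.CKProduct :=
  ⟨fun ρ => ρ.S e, memℓp_infty ⟨1, by rintro _ ⟨ρ, rfl⟩; exact ρ.isCK.norm_S_le e⟩⟩

/-- The graph C⋆-algebra `O(G)`: the universal C⋆-algebra generated by a Cuntz-Krieger `G`-family,
realized as the C⋆-algebra generated by the universal family inside the product of all
C⋆-algebras with such a family. See `isCKFamily_graphAlgebra` and `graphAlgebra_universal`. (For a
finite graph the choice of the universe is immaterial: a C⋆-algebra generated by finitely many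
elements is separable, hence has a copy in every universe.) -/
def graphAlgebra [Finite E] (G : DirectedGraph V E) : NonUnitalStarSubalgebra ℂ G.CKProduct :=
  cstarGenerated (Set.range G.prodP ∪ Set.range G.prodS)

instance [Finite E] (G : DirectedGraph V E) :
    IsClosed ((G.graphAlgebra : NonUnitalStarSubalgebra ℂ G.CKProduct) : Set G.CKProduct) :=
  NonUnitalStarSubalgebra.isClosed_topologicalClosure _

instance [Finite E] (G : DirectedGraph V E) : NonUnitalCStarAlgebra G.graphAlgebra :=
  inferInstance

/-- The canonical generating projection `p_x` of `O(G)`. -/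
def genP [Finite E] (G : DirectedGraph V E) (x : V) : G.graphAlgebra :=
  ⟨G.prodP x, NonUnitalStarSubalgebra.le_topologicalClosure _
    (NonUnitalStarAlgebra.subset_adjoin ℂ _ (Or.inl ⟨x, rfl⟩))⟩

/-- The canonical generating partial isometry `s_e` of `O(G)`. -/
def genS [Finite E] (G : DirectedGraph V E) (e : E) : G.graphAlgebra :=
  ⟨G.prodS e, NonUnitalStarSubalgebra.le_topologicalClosure _
    (NonUnitalStarAlgebra.subset_adjoin ℂ _ (Or.inr ⟨e, rfl⟩))⟩

/-- Evaluation of an element of `O(G)` at one C⋆-algebra with a Cuntz-Krieger `G`-family. -/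
def evalRep [Finite E] (G : DirectedGraph V E) (ρ : G.CKRep) : G.graphAlgebra →⋆ₙₐ[ℂ] ρ.A where
  toFun a := (a : G.CKProduct) ρ
  map_smul' _ _ := rfl
  map_zero' := rfl
  map_add' _ _ := rfl
  map_mul' _ _ := rfl
  map_star' _ := rfl

theorem evalRep_ext [Finite E] {G : DirectedGraph V E} {a b : G.graphAlgebra}
    (h : ∀ ρ, G.evalRep ρ a = G.evalRep ρ b) : a = b :=
  Subtype.ext (lp.ext (funext h))

/-- The generators of `O(G)` form a Cuntz-Krieger family. -/
theorem isCKFamily_graphAlgebra [Finite E] (G : DirectedGraph V E) :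
    G.IsCKFamily G.genP G.genS where
  projection x := ⟨evalRep_ext fun ρ => by
      rw [map_mul]; exact (ρ.isCK.projection x).isIdempotentElem,
    evalRep_ext fun ρ => by
      rw [map_star]; exact (ρ.isCK.projection x).isSelfAdjoint⟩
  partialIsometry e := evalRep_ext fun ρ => by
    simp only [map_mul, map_star]; exact ρ.isCK.partialIsometry e
  orthogonal x y hxy := evalRep_ext fun ρ => by
    simp only [map_mul, map_zero]; exact ρ.isCK.orthogonal x y hxy
  star_mul_of_ne e f hef := evalRep_ext fun ρ => by
    simp only [map_mul, map_star, map_zero]; exact ρ.isCK.star_mul_of_ne e f hef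
  star_mul_self e := evalRep_ext fun ρ => by
    simp only [map_mul, map_star]; exact ρ.isCK.star_mul_self e
  sum_range x hx := evalRep_ext fun ρ => by
    rw [finsum_mem_eq_finite_toFinset_sum _ (Set.toFinite _), map_sum]
    have := ρ.isCK.sum_range x hx
    rw [finsum_mem_eq_finite_toFinset_sum _ (Set.toFinite _)] at this
    simp only [map_mul, map_star]
    exact this

/-- The universal property of `O(G)`. -/
theorem graphAlgebra_universal [Finite E] (G : DirectedGraph V E) {B : Type u}
    [NonUnitalCStarAlgebra B] {P : V → B} {S : E → B} (h : G.IsCKFamily P S) :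
    ∃ π : G.graphAlgebra →⋆ₙₐ[ℂ] B, (∀ x, π (G.genP x) = P x) ∧ ∀ e, π (G.genS e) = S e :=
  ⟨G.evalRep ⟨B, P, S, h⟩, fun _ => rfl, fun _ => rfl⟩

/-! ## Paths -/

/-- `G.IsPath y [e₁, …, e_k]` says that `e₁ e₂ ⋯ e_k` is a path with range `y`: it walks along
`e_k` first and along `e₁` last. The empty list is the trivial path at `y`. -/
def IsPath (G : DirectedGraph V E) : V → List E → Prop
  | _, [] => True
  | y, e :: l => G.r e = y ∧ G.IsPath (G.s e) l

/-- The source of the path `e₁ e₂ ⋯ e_k` with range `y`. -/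
def sourceAux (G : DirectedGraph V E) : V → List E → V
  | y, [] => y
  | _, e :: l => G.sourceAux (G.s e) l

/-- The finite paths of `G`; the vertices are the paths of length `0`. -/
@[ext] structure Path (G : DirectedGraph V E) where
  rng : V
  edges : List E
  isPath : G.IsPath rng edges

namespace Path

variable {G : DirectedGraph V E}

/-- The length `|w|`. -/
def length (w : G.Path) : ℕ := w.edges.length

/-- The source `s(w)`. -/
def src (w : G.Path) : V := G.sourceAux w.rng w.edges

/-- The vertex `x` as a trivial path. -/
def vertex (G : DirectedGraph V E) (x : V) : G.Path := ⟨x, [], trivial⟩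

/-- The path `e w`, which walks along `w` and then along `e`. -/
def cons (e : E) (w : G.Path) (h : G.s e = w.rng) : G.Path :=
  ⟨G.r e, e :: w.edges, rfl, h ▸ w.isPath⟩

theorem isPath_take (k : ℕ) : ∀ (y : V) (l : List E), G.IsPath y l → G.IsPath y (l.take k) := by
  induction k with
  | zero => intro y l _; simp [IsPath]
  | succ k ih =>
    rintro y (_ | ⟨e, l⟩) h
    · simp [IsPath]
    · exact ⟨h.1, ih _ _ h.2⟩

/-- The remainder `w(n)` in the factorization `w = w(n) v_k ⋯ v_1` with `|v_i| = n` and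
`|w(n)| < n`: the `|w| mod n` edges of `w` that are traversed last. -/
def rem (n : ℕ) (w : G.Path) : G.Path :=
  ⟨w.rng, w.edges.take (w.length % n), isPath_take _ _ _ w.isPath⟩

end Path

/-! ## The graph `E(n)` -/

/-- `E^{<n}`: the paths of length `< n`. -/
abbrev PathLT (G : DirectedGraph V E) (n : ℕ) : Type u := {w : G.Path // w.length < n}

/-- The edges of `E(n)`: pairs `(e, w)` with `|w| < n` and `s(e) = r(w)`. -/
abbrev EdgeLT (G : DirectedGraph V E) (n : ℕ) : Type u :=
  {p : E × G.PathLT n // G.s p.1 = p.2.1.rng}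

/-- The graph `E(n)`: `s(e,w) = w`, and `r(e,w)` is `e w` if `|w| < n - 1` and the vertex `r(e)` if
`|w| = n - 1`. -/
def pathGraph (G : DirectedGraph V E) (n : ℕ) : DirectedGraph (G.PathLT n) (G.EdgeLT n) where
  s p := p.1.2
  r p :=
    if h : p.1.2.1.length + 1 < n then ⟨Path.cons p.1.1 p.1.2.1 p.2, h⟩
    else ⟨Path.vertex G (G.r p.1.1), Nat.zero_lt_of_lt p.1.2.2⟩

instance [Finite V] [Finite E] (G : DirectedGraph V E) (n : ℕ) : Finite (G.PathLT n) := by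
  have hl : Finite {l : List E // l.length < n} := (List.finite_length_lt E n).to_subtype
  refine Finite.of_injective
    (fun w : G.PathLT n => ((w.1.rng, ⟨w.1.edges, w.2⟩) : V × {l : List E // l.length < n})) ?_
  rintro ⟨w, hw⟩ ⟨w', hw'⟩ h
  rw [Prod.mk.injEq] at h
  exact Subtype.ext (Path.ext h.1 (congrArg Subtype.val h.2))

/-! ## Operators on `H_E = ℓ²(E^*)` -/

end DirectedGraph

/-- The partial isometry of `ℓ²(ι)` with `ξ_i ↦ ξ_{f(i)}` where the partial injection `f` is defined
and `ξ_i ↦ 0` elsewhere; see `partialShift_single`. -/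
def partialShift {ι : Type*} (f : ι ≃. ι) : ℓ²(ι, ℂ) →L[ℂ] ℓ²(ι, ℂ) :=
  have key : ∀ (x : ℓ²(ι, ℂ)) (t : Finset ι),
      ∑ j ∈ t, ‖((f.symm j).elim 0 x : ℂ)‖ ^ (2 : ℝ≥0∞).toReal ≤ ‖x‖ ^ (2 : ℝ≥0∞).toReal := by
    classical
    intro x t
    refine le_trans ?_ (lp.sum_rpow_le_norm_rpow (by norm_num) x (t.biUnion
      fun j => (f.symm j).toFinset))
    rw [Finset.sum_biUnion]
    · refine Finset.sum_le_sum fun j _ => ?_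
      cases h : f.symm j <;> simp
    · intro j _ k _ hjk
      refine Finset.disjoint_left.2 fun i hi hi' => hjk ?_
      exact f.symm.inj (Option.mem_toFinset.1 hi) (Option.mem_toFinset.1 hi')
  LinearMap.mkContinuous
    { toFun := fun x => ⟨fun j => (f.symm j).elim 0 x, memℓp_gen' (key x)⟩
      map_add' := fun x y => by
        ext j
        change (f.symm j).elim 0 ⇑(x + y) = (f.symm j).elim 0 x + (f.symm j).elim 0 y
        rw [lp.coeFn_add]
        cases f.symm j with
        | none => exact (add_zero (0 : ℂ)).symm
        | some k => rfl
      map_smul' := fun c x => by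
        ext j
        change (f.symm j).elim 0 ⇑(c • x) = c * (f.symm j).elim 0 x
        cases f.symm j <;> simp } 1 fun x => by
    rw [one_mul]
    exact lp.norm_le_of_forall_sum_le (by norm_num) (norm_nonneg _) (key x)

theorem partialShift_apply {ι : Type*} (f : ι ≃. ι) (x : ℓ²(ι, ℂ)) (j : ι) :
    partialShift f x j = (f.symm j).elim 0 x := rfl

open Classical in
theorem partialShift_single {ι : Type*} (f : ι ≃. ι) (i : ι) :
    partialShift f (lp.single 2 i 1) = (f i).elim 0 fun j => lp.single 2 j 1 := by
  ext j
  rw [partialShift_apply]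
  cases h : f.symm j with
  | none =>
    cases h' : f i with
    | none => rfl
    | some k =>
      have : j ≠ k := by
        rintro rfl
        rw [(f.eq_some_iff).2 h'] at h
        simp at h
      simp [this]
  | some k =>
    have hk : f k = some j := (f.eq_some_iff).1 h
    by_cases hki : k = i
    · subst hki; simp [hk]
    · cases h' : f i with
      | none => simp [hki]
      | some l =>
        have : j ≠ l := by
          rintro rfl
          exact hki (f.inj hk h')
        simp [hki, this]

open Classical in
theorem ell2_ext {ι : Type*} {S T : ℓ²(ι, ℂ) →L[ℂ] ℓ²(ι, ℂ)}
    (h : ∀ i, S (lp.single 2 i 1) = T (lp.single 2 i 1)) : S = T := by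
  refine lp.ext_continuousLinearMap (by norm_num) fun i => ?_
  ext1
  exact h i

namespace DirectedGraph

variable {V E : Type u}

/-- The Hilbert space `H_E = ℓ²(E^*)`. -/
abbrev FockSpace (G : DirectedGraph V E) : Type u := ℓ²(G.Path, ℂ)

/-- The algebra of bounded operators on `H_E`. -/
abbrev FockOp (G : DirectedGraph V E) : Type u := G.FockSpace →L[ℂ] G.FockSpace

open Classical in
/-- The basis vector `ξ_w`. -/
def xi (G : DirectedGraph V E) (w : G.Path) : G.FockSpace := lp.single 2 w 1

open Classical in
/-- The partial injection `w ↦ e w` on paths, defined if `s(e) = r(w)`. -/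
def consPEquiv (G : DirectedGraph V E) (e : E) : G.Path ≃. G.Path where
  toFun w := if h : G.s e = w.rng then some (w.cons e h) else none
  invFun
    | ⟨_, [], _⟩ => none
    | ⟨_, e' :: l, h⟩ => if e' = e then some ⟨G.s e', l, h.2⟩ else none
  inv w u := by
    obtain ⟨x, k, hk⟩ := w
    obtain ⟨y, _ | ⟨e', l⟩, h⟩ := u
    · by_cases hx : G.s e = x <;> simp [hx, Path.cons, DirectedGraph.Path.ext_iff]
    · obtain ⟨rfl, h2⟩ := h
      by_cases hx : G.s e = x
      · subst hx
        by_cases he : e' = e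
        · subst he
          simp [Path.cons, DirectedGraph.Path.ext_iff, eq_comm]
        · simp [Path.cons, DirectedGraph.Path.ext_iff, he, Ne.symm he]
      · by_cases he : e' = e
        · subst he
          simp [hx]
        · simp [hx, he]

open Classical in
/-- The projection `Q_w` onto the closed span of the `ξ_{w'}` with `w'(n) = w`. -/
def opQ (G : DirectedGraph V E) (n : ℕ) (w : G.PathLT n) : G.FockOp :=
  partialShift (PEquiv.ofSet {w' : G.Path | w'.rem n = w.1})

open Classical in
/-- The operator `T_{(e,w)}`: `ξ_{w'} ↦ ξ_{e w'}` if `w'(n) = w`, and `ξ_{w'} ↦ 0` otherwise. -/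
def opT (G : DirectedGraph V E) (n : ℕ) (p : G.EdgeLT n) : G.FockOp :=
  partialShift ((PEquiv.ofSet {w' : G.Path | w'.rem n = p.1.2.1}).trans (G.consPEquiv p.1.1))

open Classical in
/-- The projection `R_x` onto the closed span of the `ξ_w` with `s(w) = x`. -/
def opR (G : DirectedGraph V E) (x : V) : G.FockOp :=
  partialShift (PEquiv.ofSet {w : G.Path | w.src = x})

open Classical in
theorem opQ_xi (G : DirectedGraph V E) (n : ℕ) (w : G.PathLT n) (w' : G.Path) :
    G.opQ n w (G.xi w') = if w'.rem n = w.1 then G.xi w' else 0 := by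
  rw [opQ, xi, partialShift_single]
  split_ifs with h <;> simp [PEquiv.ofSet, h]

open Classical in
theorem opR_xi (G : DirectedGraph V E) (x : V) (w : G.Path) :
    G.opR x (G.xi w) = if w.src = x then G.xi w else 0 := by
  rw [opR, xi, partialShift_single]
  split_ifs with h <;> simp [PEquiv.ofSet, h]

theorem opT_xi_of_eq (G : DirectedGraph V E) (n : ℕ) (p : G.EdgeLT n) (w' : G.Path)
    (h : w'.rem n = p.1.2.1) :
    G.opT n p (G.xi w') =
      G.xi (w'.cons p.1.1 (p.2.trans (congrArg Path.rng h).symm)) := by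
  have hs : G.s p.1.1 = w'.rng := p.2.trans (congrArg Path.rng h).symm
  rw [opT, xi, partialShift_single]
  simp [PEquiv.trans, PEquiv.ofSet, h, consPEquiv, hs, xi]

theorem opT_xi_of_ne (G : DirectedGraph V E) (n : ℕ) (p : G.EdgeLT n) (w' : G.Path)
    (h : w'.rem n ≠ p.1.2.1) : G.opT n p (G.xi w') = 0 := by
  rw [opT, xi, partialShift_single]
  simp [PEquiv.trans, PEquiv.ofSet, h]

/-! ## Periodic weighted shifts and the algebra `A(n)` -/

open Classical in
/-- `(T_e)` is the weighted shift on `H_E` with weights `lam`: `T_e ξ_w = lam(e w) ξ_{e w}`, which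
means `0` if `s(e) ≠ r(w)`. (The values of `lam` at the vertices play no role.) -/
def IsWeightedShift (G : DirectedGraph V E) (T : E → G.FockOp) (lam : G.Path → ℂ) : Prop :=
  ∀ (e : E) (w : G.Path), T e (G.xi w) =
    if h : G.s e = w.rng then lam (w.cons e h) • G.xi (w.cons e h) else 0

/-- The weights have period `n`: `lam(e w) = lam(e w(n))`, so that `lam` is determined by the
remainder weights `lam(u)`, `1 ≤ |u| ≤ n`. -/
def IsPeriodic (G : DirectedGraph V E) (n : ℕ) (lam : G.Path → ℂ) : Prop :=
  ∀ (e : E) (w : G.Path) (h : G.s e = w.rng), lam (w.cons e h) = lam ((w.rem n).cons e h)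

/-- `A(n)`: the C⋆-algebra generated by the operators `T_e` of all weighted shifts of period `n`. -/
def shiftAlgebra (G : DirectedGraph V E) (n : ℕ) : NonUnitalStarSubalgebra ℂ G.FockOp :=
  cstarGenerated {X | ∃ (T : E → G.FockOp) (lam : G.Path → ℂ),
    G.IsWeightedShift T lam ∧ G.IsPeriodic n lam ∧ ∃ e, X = T e}

end DirectedGraph

/-! ## Quotients by ⋆-ideals, and the Calkin algebra -/

/-- A two-sided ideal that is closed under scalars and under the involution. -/
structure StarIdeal (A : Type*) [NonUnitalRing A] [StarRing A] [Module ℂ A]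
    extends Submodule ℂ A where
  mul_mem_left' : ∀ a b, b ∈ carrier → a * b ∈ carrier
  mul_mem_right' : ∀ a b, b ∈ carrier → b * a ∈ carrier
  star_mem' : ∀ b, b ∈ carrier → star b ∈ carrier

namespace StarIdeal

variable {A : Type*} [NonUnitalRing A] [StarRing A] [Module ℂ A]

/-- The quotient ⋆-algebra `A / I`. -/
def Quotient (I : StarIdeal A) : Type _ := A ⧸ I.toSubmodule

instance (I : StarIdeal A) : AddCommGroup I.Quotient :=
  inferInstanceAs (AddCommGroup (A ⧸ I.toSubmodule))

instance (I : StarIdeal A) : Module ℂ I.Quotient :=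
  inferInstanceAs (Module ℂ (A ⧸ I.toSubmodule))

/-- The class of an element in the quotient. -/
def cls (I : StarIdeal A) (a : A) : I.Quotient := Submodule.Quotient.mk a

theorem cls_eq_mk (I : StarIdeal A) {a b : A} : I.cls a = I.cls b ↔ a - b ∈ I.toSubmodule :=
  Submodule.Quotient.eq I.toSubmodule

theorem cls_surjective (I : StarIdeal A) : Function.Surjective I.cls :=
  Submodule.Quotient.mk_surjective _

instance (I : StarIdeal A) : Mul I.Quotient where
  mul x y := Quotient.liftOn₂' x y (fun a b => I.cls (a * b)) fun a b a' b' ha hb => by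
    rw [Submodule.quotientRel_def] at ha hb
    refine I.cls_eq_mk.2 ?_
    have : a * b - a' * b' = a * (b - b') + (a - a') * b' := by
      rw [mul_sub, sub_mul]; abel
    rw [this]
    exact I.toSubmodule.add_mem (I.mul_mem_left' _ _ hb) (I.mul_mem_right' _ _ ha)

instance (I : StarIdeal A) : Star I.Quotient where
  star x := Quotient.liftOn' x (fun a => I.cls (star a)) fun a a' ha => by
    rw [Submodule.quotientRel_def] at ha
    refine I.cls_eq_mk.2 ?_
    rw [← star_sub]
    exact I.star_mem' _ ha

theorem cls_mul (I : StarIdeal A) (a b : A) : I.cls (a * b) = I.cls a * I.cls b := rfl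
theorem cls_star (I : StarIdeal A) (a : A) : I.cls (star a) = star (I.cls a) := rfl
theorem cls_add (I : StarIdeal A) (a b : A) : I.cls (a + b) = I.cls a + I.cls b := rfl
theorem cls_zero (I : StarIdeal A) : I.cls 0 = 0 := rfl
theorem cls_smul (I : StarIdeal A) (c : ℂ) (a : A) : I.cls (c • a) = c • I.cls a := rfl

instance (I : StarIdeal A) : NonUnitalRing I.Quotient where
  left_distrib x y z := by
    obtain ⟨a, rfl⟩ := I.cls_surjective x
    obtain ⟨b, rfl⟩ := I.cls_surjective y
    obtain ⟨c, rfl⟩ := I.cls_surjective z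
    simp only [← cls_mul, ← cls_add, mul_add]
  right_distrib x y z := by
    obtain ⟨a, rfl⟩ := I.cls_surjective x
    obtain ⟨b, rfl⟩ := I.cls_surjective y
    obtain ⟨c, rfl⟩ := I.cls_surjective z
    simp only [← cls_mul, ← cls_add, add_mul]
  zero_mul x := by
    obtain ⟨a, rfl⟩ := I.cls_surjective x
    simp only [← cls_mul, ← cls_zero, zero_mul]
  mul_zero x := by
    obtain ⟨a, rfl⟩ := I.cls_surjective x
    simp only [← cls_mul, ← cls_zero, mul_zero]
  mul_assoc x y z := by
    obtain ⟨a, rfl⟩ := I.cls_surjective x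
    obtain ⟨b, rfl⟩ := I.cls_surjective y
    obtain ⟨c, rfl⟩ := I.cls_surjective z
    simp only [← cls_mul, mul_assoc]

instance (I : StarIdeal A) : StarRing I.Quotient where
  star_involutive x := by
    obtain ⟨a, rfl⟩ := I.cls_surjective x
    simp only [← cls_star, star_star]
  star_mul x y := by
    obtain ⟨a, rfl⟩ := I.cls_surjective x
    obtain ⟨b, rfl⟩ := I.cls_surjective y
    simp only [← cls_star, ← cls_mul, star_mul]
  star_add x y := by
    obtain ⟨a, rfl⟩ := I.cls_surjective x
    obtain ⟨b, rfl⟩ := I.cls_surjective y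
    simp only [← cls_star, ← cls_add, star_add]

end StarIdeal

/-- The adjoint of a compact operator on a Hilbert space is compact. -/
theorem IsCompactOperator.star_clm {H : Type*} [NormedAddCommGroup H] [InnerProductSpace ℂ H]
    [CompleteSpace H] {T : H →L[ℂ] H} (hT : IsCompactOperator T) :
    IsCompactOperator (star T : H →L[ℂ] H) := by
  have hTT : IsCompactOperator (T * star T : H →L[ℂ] H) := hT.comp_clm (star T)
  refine (isCompactOperator_iff_isCompact_closure_image_closedBall
    ((star T : H →L[ℂ] H) : H →ₗ[ℂ] H) one_pos).2 ?_
  have hc := (isCompactOperator_iff_isCompact_closure_image_closedBall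
    ((T * star T : H →L[ℂ] H) : H →ₗ[ℂ] H) one_pos).1 hTT
  have htb := (hc.totallyBounded.subset subset_closure)
  refine TotallyBounded.isCompact_of_isClosed (TotallyBounded.closure ?_) isClosed_closure
  rw [Metric.totallyBounded_iff]
  intro ε hε
  obtain ⟨t, hts, htf, hcov⟩ := totallyBounded_iff_subset.1 htb _
    (Metric.dist_mem_uniformity (show 0 < ε ^ 2 / 4 by positivity))
  obtain ⟨t', ht's, ht'f, rfl⟩ := Set.exists_subset_image_finite_and.1 ⟨t, hts, htf, rfl⟩
  refine ⟨(star T : H →L[ℂ] H) '' t', ht'f.image _, ?_⟩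
  rintro _ ⟨x, hx, rfl⟩
  have hx' := hcov ⟨x, hx, rfl⟩
  simp only [Set.mem_iUnion, Set.mem_image, exists_prop, exists_exists_and_eq_and] at hx' ⊢
  obtain ⟨y, hy, hxy⟩ := hx'
  refine ⟨y, hy, ?_⟩
  have hxy' : ‖T ((star T : H →L[ℂ] H) (x - y))‖ < ε ^ 2 / 4 := by
    simpa [dist_eq_norm, map_sub] using hxy
  have hb : ‖x - y‖ ≤ 2 := by
    have h1 := mem_closedBall_zero_iff.1 hx
    have h2 := mem_closedBall_zero_iff.1 (ht's hy)
    linarith [norm_sub_le x y]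
  have hsq : ‖(star T : H →L[ℂ] H) (x - y)‖ ^ 2 ≤ ‖T ((star T : H →L[ℂ] H) (x - y))‖ * ‖x - y‖ := by
    rw [← @inner_self_eq_norm_sq ℂ]
    rw [ContinuousLinearMap.star_eq_adjoint, ContinuousLinearMap.adjoint_inner_right]
    exact (RCLike.re_le_norm _).trans (norm_inner_le_norm _ _)
  have : ‖(star T : H →L[ℂ] H) (x - y)‖ < ε := by
    by_contra! hcon
    nlinarith [norm_nonneg (T ((star T : H →L[ℂ] H) (x - y))), norm_nonneg (x - y)]
  simpa [dist_eq_norm, map_sub] using this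

/-- The ideal of compact operators. -/
def compactIdeal (H : Type*) [NormedAddCommGroup H] [InnerProductSpace ℂ H] [CompleteSpace H] :
    StarIdeal (H →L[ℂ] H) where
  carrier := {T | IsCompactOperator T}
  add_mem' := fun ha hb => ha.add hb
  zero_mem' := isCompactOperator_zero
  smul_mem' := fun c _ ha => ha.smul c
  mul_mem_left' := fun a _ hb => hb.clm_comp a
  mul_mem_right' := fun a _ hb => hb.comp_clm a
  star_mem' := fun _ hb => hb.star_clm

namespace DirectedGraph

variable {V E : Type u}

/-- The Calkin algebra of `H_E`. -/
abbrev Calkin (G : DirectedGraph V E) : Type u := (compactIdeal G.FockSpace).Quotient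

/-- The quotient map `q` onto the Calkin algebra. -/
abbrev calkinMk (G : DirectedGraph V E) (T : G.FockOp) : G.Calkin :=
  (compactIdeal G.FockSpace).cls T

/-! ## The ideal `K_E` and the algebra `B(n)` -/

/-- `K_E = ⨁_x R_x K R_x`, where `K` is the set of compact operators on `H_E`. -/
def compactsE [Finite V] (G : DirectedGraph V E) : Set G.FockOp :=
  {T | ∃ K : V → G.FockOp, (∀ x, IsCompactOperator (K x)) ∧
    T = ∑ᶠ x, G.opR x * K x * G.opR x}

theorem star_opR (G : DirectedGraph V E) (x : V) : star (G.opR x) = G.opR x := by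
  rw [ContinuousLinearMap.star_eq_adjoint, eq_comm, ContinuousLinearMap.eq_adjoint_iff]
  intro a b
  rw [lp.inner_eq_tsum, lp.inner_eq_tsum]
  refine tsum_congr fun w => ?_
  simp only [opR, partialShift_apply, PEquiv.ofSet_symm]
  by_cases h : w.src = x <;> simp [PEquiv.ofSet, h]

theorem src_cons (G : DirectedGraph V E) (e : E) (w : G.Path) (h : G.s e = w.rng) :
    (w.cons e h).src = w.src := by
  simp [Path.src, Path.cons, sourceAux, h]

/-- The elements of `A(n)` commute with the projections `R_x`. -/
theorem opR_mul_comm (G : DirectedGraph V E) (n : ℕ) {a : G.FockOp} (ha : a ∈ G.shiftAlgebra n)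
    (x : V) : G.opR x * a = a * G.opR x := by
  have hle : G.shiftAlgebra n ≤ NonUnitalStarSubalgebra.centralizer ℂ (Set.range G.opR) := by
    refine NonUnitalStarSubalgebra.topologicalClosure_minimal _ ?_
      (by rw [NonUnitalStarSubalgebra.coe_centralizer]; exact Set.isClosed_centralizer _)
    refine NonUnitalStarAlgebra.adjoin_le ?_
    rintro _ ⟨T, lam, hT, -, e, rfl⟩
    rw [SetLike.mem_coe, NonUnitalStarSubalgebra.mem_centralizer_iff]
    rintro _ ⟨y, rfl⟩
    rw [star_opR, and_self]
    refine ell2_ext fun w => ?_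
    change G.opR y (T e (G.xi w)) = T e (G.opR y (G.xi w))
    rw [hT e w, opR_xi]
    by_cases h : G.s e = w.rng <;> by_cases h' : w.src = y <;>
      simp [h, h', opR_xi, src_cons, hT e w]
  exact ((NonUnitalStarSubalgebra.mem_centralizer_iff ℂ).1 (hle ha) _ ⟨x, rfl⟩).1

/-- `K_E` as an ideal of `A(n)`. -/
def idealE [Finite V] (G : DirectedGraph V E) (n : ℕ) : StarIdeal (G.shiftAlgebra n) where
  carrier := {a | (a : G.FockOp) ∈ G.compactsE}
  add_mem' := by
    have := Fintype.ofFinite V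
    rintro a b ⟨K, hK, ha⟩ ⟨L, hL, hb⟩
    refine ⟨K + L, fun x => (hK x).add (hL x), ?_⟩
    rw [finsum_eq_sum_of_fintype] at *
    simp [ha, hb, mul_add, add_mul, Finset.sum_add_distrib]
  zero_mem' := ⟨0, fun _ => isCompactOperator_zero, by simp⟩
  smul_mem' := by
    have := Fintype.ofFinite V
    rintro c a ⟨K, hK, ha⟩
    refine ⟨c • K, fun x => (hK x).smul c, ?_⟩
    rw [finsum_eq_sum_of_fintype] at *
    simp [ha, Finset.smul_sum]
  mul_mem_left' := by
    have := Fintype.ofFinite V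
    rintro a b ⟨K, hK, hb⟩
    refine ⟨fun x => a * K x, fun x => (hK x).clm_comp (a : G.FockOp), ?_⟩
    rw [finsum_eq_sum_of_fintype] at *
    simp only [NonUnitalStarSubalgebra.coe_mul, hb, Finset.mul_sum, ← mul_assoc,
      G.opR_mul_comm n a.2]
  mul_mem_right' := by
    have := Fintype.ofFinite V
    rintro a b ⟨K, hK, hb⟩
    refine ⟨fun x => K x * a, fun x => (hK x).comp_clm (a : G.FockOp), ?_⟩
    rw [finsum_eq_sum_of_fintype] at *
    simp only [NonUnitalStarSubalgebra.coe_mul, hb, Finset.sum_mul, mul_assoc,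
      G.opR_mul_comm n a.2]
  star_mem' := by
    have := Fintype.ofFinite V
    rintro b ⟨K, hK, hb⟩
    refine ⟨fun x => star (K x), fun x => (hK x).star_clm, ?_⟩
    rw [finsum_eq_sum_of_fintype] at *
    rw [show ((star b : G.shiftAlgebra n) : G.FockOp) = star (b : G.FockOp) from rfl, hb]
    simp only [star_sum, star_mul, star_opR, mul_assoc]

/-- `B(n) = A(n) / K_E`. -/
abbrev shiftQuotient [Finite V] (G : DirectedGraph V E) (n : ℕ) : Type u := (G.idealE n).Quotient

end DirectedGraph

end

/-! The Cuntz–Krieger relations of E(n) hold for the `Q_w`, `T_(e,w)` up to rank-one defects at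
trivial paths (`opQ_sub_sum_opT_mul_star`), hence exactly in the Calkin algebra. The substance is
that π is bounded below. This is shown by averaging, not by a gauge-invariant uniqueness theorem.

For a Cuntz–Krieger E(n)-family (P, S) in a C⋆-algebra B, let S_u be the product of the partial
isometries along the path u, and put Φ_N(T) = N⁻¹ ∑ ⟨T ξ_v, ξ_u⟩ S_u S_v^*, where |u| and |v| range
over [nN, 2nN). Without sources, the S_u S_u^* of n consecutive levels add up to ∑ P_w
(`sum_pathElem`, `sum_pathElem_period`), so the row of the S_u has squared norm at most N and Φ_N is
contractive (`norm_compression_le`). Since T_p moves every level to the next, Φ_N(T_p Y) and S_p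
Φ_N(Y) differ by two boundary levels only, an error of order N^(-1/2); likewise for T_p^*. Compact
operators are killed in the limit because the window of lengths escapes to infinity. So if T is a
⋆-polynomial in the T_p and b the same polynomial in the S_p, then Φ_N(T) → b and ‖b‖ ≤ ‖q(T)‖
(`CompressesTo.norm_le`). For B = O(E(n)) this says ‖x‖ ≤ ‖π x‖ on a dense ⋆-subalgebra, hence
everywhere.

For the range, A(n) is generated by the T_p (`opT_mem_shiftAlgebra`, `shiftAlgebra_le`), and both
π(O(E(n))) and q(A(n)) are closed. Without sinks, every Q_w is some T_p^* T_p; the rank-one defects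
and then all matrix units between paths with a common source lie in A(n), which gives K_E ⊆ A(n). As
A(n) commutes with the R_x, a compact element of A(n) lies in K_E, so on A(n) equality modulo K_E
and modulo the compacts agree. -/

noncomputable section

open Filter Topology

/-! ## Operators on `ℓ²(ι)` -/

section Ell2

variable {ι : Type*}

open Classical in
/-- The standard basis vector of `ℓ²(ι)`. -/
def ell2Basis (i : ι) : ℓ²(ι, ℂ) := lp.single 2 i 1

open Classical in
theorem ell2Basis_apply (i j : ι) : ell2Basis i j = if j = i then 1 else 0 := by
  simp [ell2Basis, Pi.single_apply]

theorem inner_ell2Basis_left (i : ι) (x : ℓ²(ι, ℂ)) : inner ℂ (ell2Basis i) x = x i := by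
  classical
  rw [ell2Basis, lp.inner_single_left]
  simp

/-- Coordinates of an adjoint are read off from the values on basis vectors; the adjoints of the
`partialShift` and `opT` operators are computed this way. -/
theorem star_clm_apply (T : ℓ²(ι, ℂ) →L[ℂ] ℓ²(ι, ℂ)) (x : ℓ²(ι, ℂ)) (i : ι) :
    (star T) x i = inner ℂ (T (ell2Basis i)) x := by
  rw [← inner_ell2Basis_left, ContinuousLinearMap.star_eq_adjoint,
    ContinuousLinearMap.adjoint_inner_right]

theorem partialShift_ell2Basis (f : ι ≃. ι) (i : ι) :
    partialShift f (ell2Basis i) = (f i).elim 0 ell2Basis := by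
  classical
  rw [ell2Basis, partialShift_single]
  cases f i <;> simp [ell2Basis]

theorem star_partialShift (f : ι ≃. ι) : star (partialShift f) = partialShift f.symm := by
  refine ContinuousLinearMap.ext fun x => ?_
  ext i
  rw [star_clm_apply, partialShift_ell2Basis, partialShift_apply, PEquiv.symm_symm]
  cases f i with
  | none => simp
  | some j => simp [inner_ell2Basis_left]

theorem partialShift_mul (g f : ι ≃. ι) :
    partialShift g * partialShift f = partialShift (f.trans g) := by
  refine ContinuousLinearMap.ext fun x => ?_
  ext i
  rw [mul_apply_eq_comp, partialShift_apply, partialShift_apply,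
    PEquiv.symm_trans_rev]
  change _ = ((g.symm i).bind f.symm).elim 0 _
  cases g.symm i with
  | none => rfl
  | some j => rfl

theorem isStarProjection_partialShift_ofSet (s : Set ι) [DecidablePred (· ∈ s)] :
    IsStarProjection (partialShift (PEquiv.ofSet s)) where
  isIdempotentElem := by
    rw [IsIdempotentElem, partialShift_mul]
    congr 1
    ext i j
    by_cases h : i ∈ s <;> simp [PEquiv.trans, PEquiv.ofSet, h]
  isSelfAdjoint := by rw [IsSelfAdjoint, star_partialShift, PEquiv.ofSet_symm]

theorem partialShift_ofSet_apply (s : Set ι) [DecidablePred (· ∈ s)] (x : ℓ²(ι, ℂ)) (i : ι) :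
    partialShift (PEquiv.ofSet s) x i = if i ∈ s then x i else 0 := by
  rw [partialShift_apply, PEquiv.ofSet_symm]
  by_cases h : i ∈ s <;> simp [PEquiv.ofSet, h]

/-- The matrix unit `ξ_k ↦ δ_{jk} ξ_i`. -/
def matrixUnit (i j : ι) : ℓ²(ι, ℂ) →L[ℂ] ℓ²(ι, ℂ) :=
  InnerProductSpace.rankOne ℂ (ell2Basis i) (ell2Basis j)

theorem matrixUnit_apply (i j : ι) (x : ℓ²(ι, ℂ)) : matrixUnit i j x = x j • ell2Basis i := by
  rw [matrixUnit, InnerProductSpace.rankOne_apply, inner_ell2Basis_left]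

theorem clm_mul_matrixUnit {T : ℓ²(ι, ℂ) →L[ℂ] ℓ²(ι, ℂ)} {i j k : ι}
    (h : T (ell2Basis i) = ell2Basis k) : T * matrixUnit i j = matrixUnit k j := by
  refine ContinuousLinearMap.ext fun x => ?_
  rw [mul_apply_eq_comp, matrixUnit_apply, map_smul, h, matrixUnit_apply]

theorem star_matrixUnit (i j : ι) : star (matrixUnit i j) = matrixUnit j i := by
  rw [matrixUnit, ContinuousLinearMap.star_eq_adjoint, InnerProductSpace.adjoint_rankOne]
  rfl

theorem isCompactOperator_matrixUnit (i j : ι) : IsCompactOperator (matrixUnit i j) := by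
  rw [matrixUnit, InnerProductSpace.rankOne_def']
  exact (isCompactOperator_of_locallyCompactSpace_dom
    (innerSL ℂ (ell2Basis j))).clm_comp (ContinuousLinearMap.toSpanSingleton ℂ (ell2Basis i))

open Classical in
/-- The projection of `ℓ²(ι)` onto the span of finitely many basis vectors. -/
def finProj (F : Finset ι) : ℓ²(ι, ℂ) →L[ℂ] ℓ²(ι, ℂ) := partialShift (PEquiv.ofSet (F : Set ι))

theorem isStarProjection_finProj (F : Finset ι) : IsStarProjection (finProj F) :=
  open Classical in isStarProjection_partialShift_ofSet _

theorem finProj_eq_sum (F : Finset ι) : finProj F = ∑ i ∈ F, matrixUnit i i := by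
  classical
  refine ContinuousLinearMap.ext fun x => ?_
  ext j
  rw [finProj, partialShift_ofSet_apply, sum_apply]
  simp only [matrixUnit_apply]
  rw [lp.coeFn_sum, Finset.sum_apply]
  simp [ell2Basis_apply]

theorem isCompactOperator_finset_sum {κ H : Type*} [NormedAddCommGroup H] [NormedSpace ℂ H]
    (F : Finset κ) (K : κ → H →L[ℂ] H) (h : ∀ i ∈ F, IsCompactOperator (K i)) :
    IsCompactOperator (∑ i ∈ F, K i : H →L[ℂ] H) := by
  classical
  induction F using Finset.induction_on with
  | empty => exact isCompactOperator_zero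
  | insert i F hi ih =>
    rw [Finset.sum_insert hi]
    exact (h i (by simp)).add (ih fun j hj => h j (by simp [hj]))

theorem isCompactOperator_finProj (F : Finset ι) : IsCompactOperator (finProj F) := by
  rw [finProj_eq_sum]
  exact isCompactOperator_finset_sum _ _ fun i _ => isCompactOperator_matrixUnit i i

theorem tendsto_finProj_apply (x : ℓ²(ι, ℂ)) :
    Tendsto (fun F => finProj F x) atTop (𝓝 x) := by
  classical
  have h : Tendsto _ _ _ := lp.hasSum_single (E := fun _ : ι => ℂ) (p := 2) (by norm_num) x
  refine h.congr fun F => ?_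
  ext j
  rw [finProj, partialShift_ofSet_apply, lp.coeFn_sum, Finset.sum_apply]
  simp [Pi.single_apply]

theorem norm_finProj_le (F : Finset ι) : ‖finProj F‖ ≤ 1 :=
  IsStarProjection.norm_le _ (isStarProjection_finProj F)

theorem norm_one_sub_finProj_le (F : Finset ι) : ‖1 - finProj F‖ ≤ 1 :=
  IsStarProjection.norm_le _ (isStarProjection_finProj F).one_sub

/-- The finite coordinate projections are a left approximate unit of the compact operators. -/
theorem tendsto_finProj_mul {K : ℓ²(ι, ℂ) →L[ℂ] ℓ²(ι, ℂ)} (hK : IsCompactOperator K) :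
    Tendsto (fun F => finProj F * K) atTop (𝓝 K) := by
  have hc := (isCompactOperator_iff_isCompact_closure_image_closedBall
    (K : ℓ²(ι, ℂ) →ₗ[ℂ] ℓ²(ι, ℂ)) one_pos).1 hK
  have htb := hc.totallyBounded.subset subset_closure
  rw [Metric.totallyBounded_iff] at htb
  rw [Metric.tendsto_nhds]
  intro ε hε
  -- Strong convergence is uniform on a finite net of the image of the unit ball. The error at `K x`
  -- is at most twice the distance to the net plus the error at a net point, whence `3 * (ε / 4)`.
  obtain ⟨t, htf, hcov⟩ := htb (ε / 4) (by positivity)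
  have hev : ∀ᶠ F in atTop, ∀ y ∈ t, dist (finProj F y) y < ε / 4 :=
    (htf.eventually_all).2 fun y _ =>
      (Metric.tendsto_nhds.1 (tendsto_finProj_apply y)) _ (by positivity)
  filter_upwards [hev] with F hF
  rw [dist_eq_norm]
  refine lt_of_le_of_lt (ContinuousLinearMap.opNorm_le_of_unit_norm (C := 3 * (ε / 4))
    (by positivity) fun x hx => ?_) (by linarith)
  have hx' := hcov ⟨x, by simp [hx], rfl⟩
  simp only [Set.mem_iUnion, exists_prop] at hx'
  obtain ⟨y, hy, hxy⟩ := hx'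
  have h1 := hF y hy
  have h2 : ‖finProj F (K x - y)‖ ≤ ‖K x - y‖ := by
    simpa using (finProj F).le_of_opNorm_le (norm_finProj_le F) (K x - y)
  rw [Metric.mem_ball, dist_eq_norm] at hxy
  rw [dist_eq_norm] at h1
  change ‖finProj F (K x) - K x‖ ≤ _
  have h3 : finProj F (K x) - K x = finProj F (K x - y) + (finProj F y - y) - (K x - y) := by
    rw [map_sub]; abel
  rw [h3]
  refine (norm_sub_le _ _).trans ?_
  have := norm_add_le (finProj F (K x - y)) (finProj F y - y)
  change ‖K x - y‖ < _ at hxy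
  linarith

/-- The finite coordinate projections are a right approximate unit of the compact operators. -/
theorem tendsto_mul_finProj {K : ℓ²(ι, ℂ) →L[ℂ] ℓ²(ι, ℂ)} (hK : IsCompactOperator K) :
    Tendsto (fun F => K * finProj F) atTop (𝓝 K) := by
  have h := (tendsto_finProj_mul hK.star_clm).star
  simpa [(isStarProjection_finProj _).isSelfAdjoint.star_eq] using h

theorem tendsto_finProj_mul_mul_finProj {K : ℓ²(ι, ℂ) →L[ℂ] ℓ²(ι, ℂ)}
    (hK : IsCompactOperator K) :
    Tendsto (fun F => finProj F * K * finProj F) atTop (𝓝 K) := by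
  have h1 := (tendsto_mul_finProj hK).sub_const K
  have h2 := tendsto_finProj_mul hK
  rw [sub_self] at h1
  have h3 : Tendsto (fun F => finProj F * (K * finProj F - K)) atTop (𝓝 0) := by
    refine squeeze_zero_norm (fun F => ?_) (tendsto_zero_iff_norm_tendsto_zero.1 h1)
    exact (norm_mul_le _ _).trans
      (mul_le_of_le_one_left (norm_nonneg _) (norm_finProj_le F))
  simpa [mul_sub, mul_assoc] using h3.add h2

theorem finProj_mul_mul_finProj (T : ℓ²(ι, ℂ) →L[ℂ] ℓ²(ι, ℂ)) (F : Finset ι) :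
    finProj F * T * finProj F = ∑ i ∈ F, ∑ j ∈ F, T (ell2Basis j) i • matrixUnit i j := by
  rw [finProj_eq_sum, Finset.sum_mul, Finset.sum_mul]
  refine Finset.sum_congr rfl fun i _ => ?_
  rw [Finset.mul_sum]
  refine Finset.sum_congr rfl fun j _ => ?_
  refine ContinuousLinearMap.ext fun x => ?_
  simp [matrixUnit_apply, smul_smul, mul_comm]

end Ell2

/-! ## The Calkin algebra of `ℓ²(ι)` as a C⋆-algebra -/

section Calkin

variable {ι : Type*}

instance isClosed_compactIdeal {H : Type*} [NormedAddCommGroup H] [InnerProductSpace ℂ H]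
    [CompleteSpace H] :
    IsClosed ((compactIdeal H).toSubmodule : Set (H →L[ℂ] H)) :=
  isClosed_setOfPred_isCompactOperator

namespace compactIdeal

instance {H : Type*} [NormedAddCommGroup H] [InnerProductSpace ℂ H] [CompleteSpace H] :
    NormedAddCommGroup (compactIdeal H).Quotient :=
  inferInstanceAs (NormedAddCommGroup ((H →L[ℂ] H) ⧸ (compactIdeal H).toSubmodule))

instance {H : Type*} [NormedAddCommGroup H] [InnerProductSpace ℂ H] [CompleteSpace H] :
    NormedSpace ℂ (compactIdeal H).Quotient :=
  inferInstanceAs (NormedSpace ℂ ((H →L[ℂ] H) ⧸ (compactIdeal H).toSubmodule))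

instance {H : Type*} [NormedAddCommGroup H] [InnerProductSpace ℂ H] [CompleteSpace H] :
    CompleteSpace (compactIdeal H).Quotient :=
  inferInstanceAs (CompleteSpace ((H →L[ℂ] H) ⧸ (compactIdeal H).toSubmodule))

section

variable {H : Type*} [NormedAddCommGroup H] [InnerProductSpace ℂ H] [CompleteSpace H]

theorem norm_cls_le (T : H →L[ℂ] H) : ‖(compactIdeal H).cls T‖ ≤ ‖T‖ :=
  Submodule.Quotient.norm_mk_le (S := (compactIdeal H).toSubmodule) T

theorem exists_cls_eq_norm_lt (x : (compactIdeal H).Quotient) {ε : ℝ} (hε : 0 < ε) :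
    ∃ T, (compactIdeal H).cls T = x ∧ ‖T‖ < ‖x‖ + ε :=
  Submodule.Quotient.norm_mk_lt (S := (compactIdeal H).toSubmodule) x hε

theorem cls_eq_cls_iff {S T : H →L[ℂ] H} :
    (compactIdeal H).cls S = (compactIdeal H).cls T ↔ IsCompactOperator (S - T) :=
  (compactIdeal H).cls_eq_mk

theorem norm_mul_le' (x y : (compactIdeal H).Quotient) : ‖x * y‖ ≤ ‖x‖ * ‖y‖ := by
  have h : ∀ ε > 0, ‖x * y‖ ≤ (‖x‖ + ε) * (‖y‖ + ε) := by
    intro ε hε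
    obtain ⟨S, rfl, hS⟩ := exists_cls_eq_norm_lt x hε
    obtain ⟨T, rfl, hT⟩ := exists_cls_eq_norm_lt y hε
    rw [← StarIdeal.cls_mul]
    refine (norm_cls_le _).trans ((norm_mul_le _ _).trans ?_)
    gcongr
  have hlim : Tendsto (fun ε : ℝ => (‖x‖ + ε) * (‖y‖ + ε)) (𝓝[>] 0) (𝓝 (‖x‖ * ‖y‖)) := by
    have : Continuous fun ε : ℝ => (‖x‖ + ε) * (‖y‖ + ε) := by fun_prop
    simpa using (this.tendsto 0).mono_left nhdsWithin_le_nhds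
  exact ge_of_tendsto hlim (eventually_mem_nhdsWithin.mono fun ε hε => h ε hε)

end

/-- The C⋆-inequality for the quotient norm. Take a nearly optimal lift A of the class of T^*T, so
that K = T^*T - A is compact. For a finite coordinate projection p, T(1 - p) is still a lift of the
class of T, and its C⋆-square is (1 - p)(A(1 - p) + (K - Kp)) with K - Kp as small as desired. -/
theorem norm_cls_mul_self_le (T : ℓ²(ι, ℂ) →L[ℂ] ℓ²(ι, ℂ)) :
    ‖(compactIdeal _).cls T‖ * ‖(compactIdeal _).cls T‖ ≤ ‖(compactIdeal _).cls (star T * T)‖ := by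
  refine le_of_forall_pos_le_add fun ε hε => ?_
  obtain ⟨A, hA, hAn⟩ := exists_cls_eq_norm_lt ((compactIdeal _).cls (star T * T)) (half_pos hε)
  have hK := cls_eq_cls_iff.1 hA.symm
  set K := star T * T - A with hKdef
  have h1 := tendsto_mul_finProj hK
  obtain ⟨F, hF⟩ := ((Metric.tendsto_nhds.1 h1) (ε / 2) (half_pos hε)).exists
  rw [dist_eq_norm'] at hF
  have hcls : ‖(compactIdeal _).cls T‖ ≤ ‖T * (1 - finProj F)‖ := by
    have : (compactIdeal _).cls T = (compactIdeal _).cls (T * (1 - finProj F)) := by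
      refine cls_eq_cls_iff.2 ?_
      rw [mul_sub, mul_one, sub_sub_cancel]
      exact (isCompactOperator_finProj F).clm_comp T
    rw [this]
    exact norm_cls_le _
  have hle : ‖T * (1 - finProj F)‖ * ‖T * (1 - finProj F)‖ ≤ ‖A‖ + ε / 2 := by
    have hsa : star (1 - finProj F) = 1 - finProj F :=
      (isStarProjection_finProj F).one_sub.isSelfAdjoint
    rw [← CStarRing.norm_star_mul_self]
    have heq : star (T * (1 - finProj F)) * (T * (1 - finProj F)) =
        (1 - finProj F) * (A * (1 - finProj F) + (K - K * finProj F)) := by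
      rw [star_mul, hsa, hKdef]
      noncomm_ring
    rw [heq]
    refine (norm_mul_le _ _).trans ((mul_le_of_le_one_left (norm_nonneg _)
      (norm_one_sub_finProj_le F)).trans ((norm_add_le _ _).trans ?_))
    refine add_le_add ((norm_mul_le _ _).trans (mul_le_of_le_one_right (norm_nonneg _)
      (norm_one_sub_finProj_le F))) hF.le
  have := mul_le_mul hcls hcls (norm_nonneg _) (norm_nonneg _)
  linarith

/-- This makes the Calkin algebra an admissible target of the universal property and makes π
automatically contractive. -/
instance : NonUnitalCStarAlgebra (compactIdeal ℓ²(ι, ℂ)).Quotient where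
  __ := (inferInstance : NormedAddCommGroup (compactIdeal ℓ²(ι, ℂ)).Quotient)
  __ := (inferInstance : NonUnitalRing (compactIdeal ℓ²(ι, ℂ)).Quotient)
  __ := (inferInstance : StarRing (compactIdeal ℓ²(ι, ℂ)).Quotient)
  __ := (inferInstance : NormedSpace ℂ (compactIdeal ℓ²(ι, ℂ)).Quotient)
  complete := CompleteSpace.complete
  norm_mul_le := norm_mul_le'
  norm_mul_self_le x := by
    obtain ⟨T, rfl⟩ := StarIdeal.cls_surjective _ x
    exact norm_cls_mul_self_le T
  smul_assoc c x y := by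
    obtain ⟨S, rfl⟩ := StarIdeal.cls_surjective _ x
    obtain ⟨T, rfl⟩ := StarIdeal.cls_surjective _ y
    exact congrArg (compactIdeal _).cls (smul_mul_assoc c S T)
  smul_comm c x y := by
    obtain ⟨S, rfl⟩ := StarIdeal.cls_surjective _ x
    obtain ⟨T, rfl⟩ := StarIdeal.cls_surjective _ y
    exact congrArg (compactIdeal _).cls (mul_smul_comm c S T).symm
  star_smul c x := by
    obtain ⟨S, rfl⟩ := StarIdeal.cls_surjective _ x
    exact congrArg (compactIdeal _).cls (star_smul c S)

/-- The essential norm of `T` is approached by `‖(1 - p) T‖`, `p` a finite coordinate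
projection. -/
theorem exists_norm_sub_finProj_mul_lt (T : ℓ²(ι, ℂ) →L[ℂ] ℓ²(ι, ℂ)) {ε : ℝ} (hε : 0 < ε) :
    ∃ F, ‖T - finProj F * T‖ < ‖(compactIdeal _).cls T‖ + ε := by
  obtain ⟨A, hA, hAn⟩ := exists_cls_eq_norm_lt ((compactIdeal _).cls T) (half_pos hε)
  have hK := cls_eq_cls_iff.1 hA.symm
  set K := T - A with hKdef
  obtain ⟨F, hF⟩ := ((Metric.tendsto_nhds.1 (tendsto_finProj_mul hK)) (ε / 2) (half_pos hε)).exists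
  rw [dist_eq_norm'] at hF
  refine ⟨F, ?_⟩
  have heq : T - finProj F * T = (1 - finProj F) * A + (K - finProj F * K) := by
    rw [hKdef]; noncomm_ring
  rw [heq]
  refine (norm_add_le _ _).trans_lt ?_
  have h2 : ‖(1 - finProj F) * A‖ ≤ ‖A‖ := (norm_mul_le _ _).trans
    (mul_le_of_le_one_left (norm_nonneg _) (norm_one_sub_finProj_le F))
  linarith

end compactIdeal

end Calkin

/-! ## Scalar matrices acting on tuples in a C⋆-algebra -/

section Amplification

variable {B : Type*} [NonUnitalCStarAlgebra B]

/-- Cauchy–Schwarz in the Hilbert C⋆-module of κ-tuples over B. -/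
theorem norm_sum_mul_star_le {κ : Type*} [Fintype κ] (x y : κ → B) :
    ‖∑ j, y j * star (x j)‖ ≤ √‖∑ j, x j * star (x j)‖ * √‖∑ j, y j * star (y j)‖ := by
  let _ := CStarAlgebra.spectralOrder B
  have _ := CStarAlgebra.spectralOrderedRing B
  exact CStarModule.norm_inner_le (A := B) (WithCStarModule B (κ → B))
    (x := (WithCStarModule.equiv B (κ → B)).symm x) (y := (WithCStarModule.equiv B (κ → B)).symm y)

open scoped ComplexOrder in
theorem Matrix.PosSemidef.exists_eq_sum {κ : Type*} [Fintype κ] {M : Matrix κ κ ℂ}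
    (hM : M.PosSemidef) : ∃ C : Matrix κ κ ℂ, ∀ i j, M i j = ∑ k, star (C k i) * C k j := by
  classical
  open scoped MatrixOrder in
  obtain ⟨C, rfl⟩ := CStarAlgebra.nonneg_iff_eq_star_mul_self.mp hM.nonneg
  exact ⟨C, fun i j => by simp [Matrix.star_eq_conjTranspose, Matrix.mul_apply]⟩

-- An elementary substitute for the bound on a scalar matrix acting on B-valued tuples. With y_j =
-- ∑_i Y_ij s_i the sum is ∑ y_j t_j^*, and Cauchy–Schwarz leaves ∑ y_j y_j^* to be estimated.
-- Factoring c² - YY^* as C^*C exhibits c² ∑ s_i s_i^* - ∑ y_j y_j^* as a sum of elements z z^*.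
open scoped ComplexOrder in
theorem norm_sum_matrix_smul_le {κ μ : Type*} [Fintype κ] [Fintype μ] [DecidableEq κ]
    (Y : Matrix κ μ ℂ) {c : ℝ} (hc : 0 ≤ c)
    (hY : (((c ^ 2 : ℝ) : ℂ) • (1 : Matrix κ κ ℂ) - Y * Y.conjTranspose).PosSemidef)
    (s : κ → B) (t : μ → B) :
    ‖∑ i, ∑ j, Y i j • (s i * star (t j))‖ ≤
      c * √‖∑ i, s i * star (s i)‖ * √‖∑ j, t j * star (t j)‖ := by
  let _ := CStarAlgebra.spectralOrder B
  have _ := CStarAlgebra.spectralOrderedRing B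
  set y : μ → B := fun j => ∑ i, Y i j • s i with hy
  have h1 : ∑ i, ∑ j, Y i j • (s i * star (t j)) = ∑ j, y j * star (t j) := by
    rw [Finset.sum_comm]
    simp only [hy, Finset.sum_mul, smul_mul_assoc]
  have h2 : ∑ j, y j * star (y j) =
      ∑ i, ∑ k, (Y * Y.conjTranspose) i k • (s i * star (s k)) := by
    simp only [hy, star_sum, star_smul, Finset.sum_mul_sum, Matrix.mul_apply,
      Matrix.conjTranspose_apply, Finset.sum_smul, smul_mul_smul_comm]
    rw [Finset.sum_comm]
    refine Finset.sum_congr rfl fun i _ => ?_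
    rw [Finset.sum_comm]
  have h3 : ∑ j, y j * star (y j) ≤ ((c ^ 2 : ℝ) : ℂ) • ∑ i, s i * star (s i) := by
    rw [← sub_nonneg, h2]
    obtain ⟨C, hC⟩ := hY.exists_eq_sum
    have h4 : ((c ^ 2 : ℝ) : ℂ) • ∑ i, s i * star (s i) -
        ∑ i, ∑ k, (Y * Y.conjTranspose) i k • (s i * star (s k)) =
        ∑ i, ∑ k, (((c ^ 2 : ℝ) : ℂ) • (1 : Matrix κ κ ℂ) - Y * Y.conjTranspose) i k •
          (s i * star (s k)) := by
      simp only [Matrix.sub_apply, sub_smul, Finset.sum_sub_distrib]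
      congr 1
      simp [Matrix.one_apply, Finset.smul_sum]
    rw [h4]
    have h5 : ∑ i, ∑ k, (((c ^ 2 : ℝ) : ℂ) • (1 : Matrix κ κ ℂ) - Y * Y.conjTranspose) i k •
          (s i * star (s k)) =
        ∑ l, (∑ i, star (C l i) • s i) * star (∑ i, star (C l i) • s i) := by
      simp only [hC, star_sum, star_smul, Finset.sum_mul_sum, Finset.sum_smul,
        smul_mul_smul_comm, star_star]
      symm
      rw [Finset.sum_comm]
      refine Finset.sum_congr rfl fun i _ => ?_
      rw [Finset.sum_comm]
    rw [h5]
    exact Finset.sum_nonneg fun l _ => mul_star_self_nonneg _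
  have h6 : ‖∑ j, y j * star (y j)‖ ≤ c ^ 2 * ‖∑ i, s i * star (s i)‖ := by
    refine (CStarAlgebra.norm_le_norm_of_nonneg_of_le
      (Finset.sum_nonneg fun j _ => mul_star_self_nonneg _) h3).trans_eq ?_
    rw [norm_smul, Complex.norm_real, Real.norm_of_nonneg (by positivity)]
  rw [h1]
  refine (norm_sum_mul_star_le t y).trans ?_
  rw [mul_comm]
  refine mul_le_mul_of_nonneg_right ?_ (Real.sqrt_nonneg _)
  refine (Real.sqrt_le_sqrt h6).trans_eq ?_
  rw [Real.sqrt_mul (by positivity), Real.sqrt_sq hc]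

/-! ### Finite corners of the matrix of an operator on ℓ²(ι). -/

variable {ι : Type*}

theorem sum_norm_sq_le (x : ℓ²(ι, ℂ)) (F : Finset ι) : ∑ i ∈ F, ‖x i‖ ^ 2 ≤ ‖x‖ ^ 2 := by
  have := lp.sum_rpow_le_norm_rpow (p := 2) (by norm_num) x F
  simpa using this

theorem norm_sq_sum_ell2Basis (F : Finset ι) (a : ι → ℂ) :
    ‖∑ i ∈ F, a i • ell2Basis i‖ ^ 2 = ∑ i ∈ F, ‖a i‖ ^ 2 := by
  classical
  have h : ((‖∑ i ∈ F, a i • ell2Basis i‖ ^ 2 : ℝ) : ℂ) = ((∑ i ∈ F, ‖a i‖ ^ 2 : ℝ) : ℂ) := by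
    rw [Complex.ofReal_pow, ← Complex.coe_algebraMap, ← inner_self_eq_norm_sq_to_K (𝕜 := ℂ)]
    push_cast
    simp only [sum_inner, inner_sum, inner_smul_left, inner_smul_right, inner_ell2Basis_left,
      ell2Basis_apply]
    refine Finset.sum_congr rfl fun i hi => ?_
    simp [hi, ← Complex.conj_mul', mul_comm]
  exact_mod_cast h

-- For z = ∑ x_i ξ_i with i in F, the entries of Y^*x are the F'-coordinates of T^*z, so ‖Y^*x‖ ≤
-- ‖T‖ ‖x‖.
open scoped ComplexOrder in
theorem posSemidef_sub_entries (T : ℓ²(ι, ℂ) →L[ℂ] ℓ²(ι, ℂ)) (F F' : Finset ι) [DecidableEq F] :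
    (((‖T‖ ^ 2 : ℝ) : ℂ) • (1 : Matrix F F ℂ) -
      (Matrix.of fun (i : F) (j : F') => T (ell2Basis j) i) *
      (Matrix.of fun (i : F) (j : F') => T (ell2Basis j) i).conjTranspose).PosSemidef := by
  set Y : Matrix F F' ℂ := Matrix.of fun (i : F) (j : F') => T (ell2Basis j) i with hYdef
  refine Matrix.PosSemidef.of_dotProduct_mulVec_nonneg ?_ fun x => ?_
  · refine Matrix.IsHermitian.sub ?_ (Matrix.isHermitian_mul_conjTranspose_self Y)
    rw [Matrix.IsHermitian, Matrix.conjTranspose_smul, Matrix.conjTranspose_one]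
    simp
  · classical
    set a : ι → ℂ := fun i => if h : i ∈ F then x ⟨i, h⟩ else 0 with ha
    set z := ∑ i ∈ F, a i • ell2Basis i with hz
    have hz' : z = ∑ i : F, x i • ell2Basis (i : ι) := by
      rw [hz, ← Finset.sum_coe_sort F]
      exact Finset.sum_congr rfl fun i _ => by simp [ha]
    have hznorm : ∑ i, ‖x i‖ ^ 2 = ‖z‖ ^ 2 := by
      rw [hz, norm_sq_sum_ell2Basis, ← Finset.sum_coe_sort F]
      exact Finset.sum_congr rfl fun i _ => by simp [ha]
    have hYx : ∀ j, (Y.conjTranspose.mulVec x) j = (star T) z j := by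
      intro j
      rw [star_clm_apply, hz', inner_sum]
      simp only [Matrix.mulVec, dotProduct, Matrix.conjTranspose_apply, inner_smul_right]
      refine Finset.sum_congr rfl fun i _ => ?_
      rw [← inner_conj_symm, inner_ell2Basis_left, hYdef, Matrix.of_apply, mul_comm]
      rfl
    have hle : ∑ j, ‖(Y.conjTranspose.mulVec x) j‖ ^ 2 ≤ ‖T‖ ^ 2 * ∑ i, ‖x i‖ ^ 2 := by
      simp only [hYx]
      rw [Finset.sum_coe_sort F' (fun j => ‖(star T) z j‖ ^ 2), hznorm, ← mul_pow]
      refine (sum_norm_sq_le _ _).trans ?_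
      gcongr
      exact (star T).le_of_opNorm_le (norm_star T).le z
    have hdot : ∀ {κ : Type _} [Fintype κ] (v : κ → ℂ),
        star v ⬝ᵥ v = ((∑ i, ‖v i‖ ^ 2 : ℝ) : ℂ) := by
      intro κ _ v
      simp [dotProduct, Complex.conj_mul']
    rw [Matrix.sub_mulVec, dotProduct_sub, ← Matrix.mulVec_mulVec, Matrix.dotProduct_mulVec _ Y,
      Matrix.smul_mulVec, Matrix.one_mulVec, dotProduct_smul, hdot,
      show Matrix.vecMul (star x) Y = star (Y.conjTranspose.mulVec x) by
        rw [Matrix.star_mulVec, Matrix.conjTranspose_conjTranspose], hdot, sub_nonneg, smul_eq_mul]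
    exact_mod_cast hle

/-- The compression of an operator on `ℓ²(ι)` to finitely many coordinates acts boundedly on
tuples in a C⋆-algebra. -/
theorem norm_sum_entries_smul_le (T : ℓ²(ι, ℂ) →L[ℂ] ℓ²(ι, ℂ)) (F F' : Finset ι) (s t : ι → B) :
    ‖∑ i ∈ F, ∑ j ∈ F', T (ell2Basis j) i • (s i * star (t j))‖ ≤
      ‖T‖ * √‖∑ i ∈ F, s i * star (s i)‖ * √‖∑ j ∈ F', t j * star (t j)‖ := by
  classical
  have h := norm_sum_matrix_smul_le _ (norm_nonneg T) (posSemidef_sub_entries T F F')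
    (fun i => s i) (fun j => t j)
  rw [Finset.sum_coe_sort F (fun i => s i * star (s i)),
    Finset.sum_coe_sort F' (fun j => t j * star (t j))] at h
  convert h using 2
  rw [← Finset.sum_coe_sort F]
  refine Finset.sum_congr rfl fun i _ => ?_
  rw [← Finset.sum_coe_sort F']
  rfl

end Amplification

namespace DirectedGraph

variable {V E : Type u}

/-! ## Consequences of the Cuntz-Krieger relations -/

namespace IsCKFamily

variable [Finite E] {F : DirectedGraph V E} {B : Type*}

section Ring

variable [NonUnitalRing B] [StarRing B] {P : V → B} {S : E → B}

theorem S_mul_P (h : F.IsCKFamily P S) (e : E) : S e * P (F.s e) = S e := by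
  rw [← h.star_mul_self, ← mul_assoc, h.partialIsometry]

/-- Expand the range projection as ∑ S_f S_f^*; orthogonality leaves only f = e. -/
theorem P_mul_S (h : F.IsCKFamily P S) (e : E) : P (F.r e) * S e = S e := by
  rw [← h.sum_range _ ⟨e, rfl⟩, finsum_mem_eq_finite_toFinset_sum _ (Set.toFinite _),
    Finset.sum_mul, Finset.sum_eq_single e, h.partialIsometry]
  · intro f _ hf
    rw [mul_assoc, h.star_mul_of_ne f e hf, mul_zero]
  · simp

theorem star_P (h : F.IsCKFamily P S) (x : V) : star (P x) = P x := (h.projection x).isSelfAdjoint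

theorem isStarProjection_sum (h : F.IsCKFamily P S) (A : Finset V) :
    IsStarProjection (∑ x ∈ A, P x) where
  isIdempotentElem := by
    classical
    rw [IsIdempotentElem, Finset.sum_mul_sum]
    refine Finset.sum_congr rfl fun x hx => ?_
    rw [Finset.sum_eq_single x, (h.projection x).isIdempotentElem]
    · exact fun y _ hy => h.orthogonal x y hy.symm
    · exact fun hx' => absurd hx hx'
  isSelfAdjoint := by
    rw [IsSelfAdjoint, star_sum]
    exact Finset.sum_congr rfl fun x _ => h.star_P x

/-- The sum of the vertex projections replaces the unit, which B need not have: it is what the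
identity operator is compressed to, and it is absorbed on the right by all generators. -/
theorem P_mul_sum (h : F.IsCKFamily P S) [Fintype V] (x : V) : P x * ∑ y, P y = P x := by
  classical
  rw [Finset.mul_sum, Finset.sum_eq_single x, (h.projection x).isIdempotentElem]
  · exact fun y _ hy => h.orthogonal x y hy.symm
  · simp

theorem S_mul_sum (h : F.IsCKFamily P S) [Fintype V] (e : E) : S e * ∑ y, P y = S e := by
  rw [← h.S_mul_P e, mul_assoc, h.P_mul_sum]

theorem star_S_mul_sum (h : F.IsCKFamily P S) [Fintype V] (e : E) :
    star (S e) * ∑ y, P y = star (S e) := by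
  have h1 : star (S e) * P (F.r e) = star (S e) := by
    rw [← h.star_P, ← star_mul, h.P_mul_S]
  rw [← h1, mul_assoc, h.P_mul_sum]

end Ring

end IsCKFamily

/-! ## Remainders and levels of paths -/

namespace Path

variable {G : DirectedGraph V E}

theorem length_vertex (x : V) : (vertex G x).length = 0 := rfl

theorem length_cons (e : E) (w : G.Path) (h : G.s e = w.rng) :
    (w.cons e h).length = w.length + 1 := rfl

theorem length_rem (n : ℕ) (w : G.Path) : (w.rem n).length = w.length % n := by
  change (w.edges.take (w.length % n)).length = _
  rw [List.length_take]
  exact min_eq_left (Nat.mod_le _ _)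

theorem rem_of_length_lt {n : ℕ} {w : G.Path} (h : w.length < n) : w.rem n = w := by
  refine Path.ext rfl ?_
  change w.edges.take (w.length % n) = w.edges
  rw [Nat.mod_eq_of_lt h]
  exact List.take_length

/-- The remainder `w(n)` as a vertex of `E(n)`. -/
def remLT (n : ℕ) (hn : 1 ≤ n) (w : G.Path) : G.PathLT n :=
  ⟨w.rem n, by rw [length_rem n]; exact Nat.mod_lt _ hn⟩

theorem remLT_val (n : ℕ) (hn : 1 ≤ n) (w : G.PathLT n) : remLT n hn w.1 = w :=
  Subtype.ext (rem_of_length_lt w.2)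

theorem eq_vertex_of_length_eq_zero {w : G.Path} (h : w.length = 0) : w = vertex G w.rng :=
  Path.ext rfl (List.length_eq_zero_iff.1 h)

theorem exists_eq_cons {w : G.Path} {L : ℕ} (hw : w.length = L + 1) :
    ∃ (e : E) (v : G.Path) (h : G.s e = v.rng), w = v.cons e h := by
  obtain ⟨x, _ | ⟨e, l⟩, hp⟩ := w
  · simp [length] at hw
  · obtain ⟨rfl, h2⟩ := hp
    exact ⟨e, ⟨G.s e, l, h2⟩, rfl, rfl⟩

theorem cons_inj {e e' : E} {w w' : G.Path} {h : G.s e = w.rng} {h' : G.s e' = w'.rng}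
    (heq : w.cons e h = w'.cons e' h') : e = e' ∧ w = w' := by
  have h1 : e :: w.edges = e' :: w'.edges := congrArg Path.edges heq
  rw [List.cons.injEq] at h1
  refine ⟨h1.1, Path.ext ?_ h1.2⟩
  rw [← h, ← h', h1.1]

/-- The remainder of `e w` is the range of the edge `(e, w(n))` of `E(n)`. -/
theorem remLT_cons {n : ℕ} (hn : 1 ≤ n) (p : G.EdgeLT n) (w : G.Path)
    (hp : p.1.2 = remLT n hn w) (h : G.s p.1.1 = w.rng) :
    remLT n hn (w.cons p.1.1 h) = (G.pathGraph n).r p := by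
  obtain ⟨⟨e, v⟩, he⟩ := p
  dsimp only at hp h
  subst hp
  have hlen : (remLT n hn w).1.length = w.length % n := length_rem n w
  refine Subtype.ext ?_
  dsimp only [pathGraph]
  -- Prolongation either adds one edge to the remainder or, when the remainder has length n - 1,
  -- completes a block of n edges and resets it to a vertex.
  split_ifs with hlt
  · rw [hlen] at hlt
    refine Path.ext rfl ?_
    change (e :: w.edges).take ((w.length + 1) % n) = e :: w.edges.take (w.length % n)
    have : (w.length + 1) % n = w.length % n + 1 := by
      rw [Nat.add_mod, Nat.mod_eq_of_lt (a := 1) (by omega), Nat.mod_eq_of_lt hlt]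
    rw [this, List.take_succ_cons]
  · rw [hlen] at hlt
    refine Path.ext rfl ?_
    change (e :: w.edges).take ((w.length + 1) % n) = []
    have h1 := Nat.mod_lt w.length hn
    have h2 : w.length % n = n - 1 := by omega
    have : (w.length + 1) % n = 0 := by
      rw [Nat.add_mod, h2, Nat.add_mod_mod, Nat.sub_add_cancel hn, Nat.mod_self]
    rw [this, List.take_zero]

end Path

variable {G : DirectedGraph V E}

theorem length_pathGraph_r {n : ℕ} (hn : 1 ≤ n) (p : G.EdgeLT n) :
    ((G.pathGraph n).r p).1.length = (p.1.2.1.length + 1) % n := by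
  have h : p.1.2 = Path.remLT n hn p.1.2.1 := (Path.remLT_val n hn _).symm
  rw [← Path.remLT_cons hn p _ h p.2]
  exact Path.length_rem n _

theorem rng_eq_of_snd_eq_remLT {n : ℕ} {hn : 1 ≤ n} {p : G.EdgeLT n} {w : G.Path}
    (hp : p.1.2 = Path.remLT n hn w) : G.s p.1.1 = w.rng := by
  rw [p.2, hp]; rfl

/-- Every w in E^{<n} is the remainder of a path of positive length: w itself if |w| > 0, otherwise
a path of length n with the same range, available since G has no sources. Its last edge e, together
with the remainder of what precedes, is an edge of E(n) with range w. -/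
theorem noSources_pathGraph (hG : G.NoSources) {n : ℕ} (hn : 1 ≤ n) :
    (G.pathGraph n).NoSources := by
  have hex : ∀ (L : ℕ) (x : V), ∃ w : G.Path, w.rng = x ∧ w.length = L := by
    intro L
    induction L with
    | zero => exact fun x => ⟨Path.vertex G x, rfl, rfl⟩
    | succ L ih =>
      intro x
      obtain ⟨e, rfl⟩ := hG x
      obtain ⟨w, hw, rfl⟩ := ih (G.s e)
      exact ⟨w.cons e hw.symm, rfl, rfl⟩
  rintro ⟨w, hw⟩
  obtain ⟨v, h1, h2⟩ : ∃ v : G.Path, v.rem n = w ∧ v.length ≠ 0 := by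
    by_cases h0 : w.length = 0
    · obtain ⟨v, hv, hvn⟩ := hex n w.rng
      refine ⟨v, ?_, by omega⟩
      rw [Path.eq_vertex_of_length_eq_zero h0]
      refine Path.ext hv ?_
      change v.edges.take (v.length % n) = []
      rw [hvn, Nat.mod_self, List.take_zero]
    · exact ⟨w, Path.rem_of_length_lt hw, h0⟩
  obtain ⟨L, hL⟩ := Nat.exists_eq_succ_of_ne_zero h2
  obtain ⟨e, u, he, rfl⟩ := Path.exists_eq_cons hL
  refine ⟨⟨(e, Path.remLT n hn u), he⟩, ?_⟩
  rw [← Path.remLT_cons hn ⟨(e, Path.remLT n hn u), he⟩ u rfl he]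
  exact Subtype.ext h1

section Levels

variable [Finite V] [Finite E] (G)

theorem finite_length_eq (L : ℕ) : {w : G.Path | w.length = L}.Finite := by
  refine ((Set.finite_range (Subtype.val : G.PathLT (L + 1) → G.Path))).subset ?_
  rintro w rfl
  exact ⟨⟨w, Nat.lt_succ_self _⟩, rfl⟩

/-- The finite set of paths of length `L`. -/
def pathsOfLength (L : ℕ) : Finset G.Path := (G.finite_length_eq L).toFinset

variable {G}

theorem mem_pathsOfLength {L : ℕ} {w : G.Path} : w ∈ G.pathsOfLength L ↔ w.length = L := by
  simp [pathsOfLength]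

variable (G) in
open Classical in
/-- The finite set of paths of length in `[a, b)`. -/
def pathsIco (a b : ℕ) : Finset G.Path := (Finset.Ico a b).biUnion G.pathsOfLength

theorem sum_pathsIco {M : Type*} [AddCommMonoid M] (a b : ℕ) (f : G.Path → M) :
    ∑ u ∈ G.pathsIco a b, f u = ∑ L ∈ Finset.Ico a b, ∑ u ∈ G.pathsOfLength L, f u := by
  classical
  refine Finset.sum_biUnion fun L _ L' _ hL => Finset.disjoint_left.2 fun u hu hu' => hL ?_
  rw [← mem_pathsOfLength.1 hu, mem_pathsOfLength.1 hu']

theorem le_length_of_mem_pathsIco {a b : ℕ} {w : G.Path} (h : w ∈ G.pathsIco a b) :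
    a ≤ w.length := by
  simp only [pathsIco, Finset.mem_biUnion, Finset.mem_Ico, mem_pathsOfLength] at h
  obtain ⟨L, h1, h2⟩ := h
  omega

open Classical in
/-- Every path of length `L + 1` is obtained from exactly one path `v` of length `L` by
prolongation along exactly one edge of `E(n)` with source `v(n)`. -/
theorem sum_pathsOfLength_succ {M : Type*} [AddCommMonoid M] {n : ℕ} (hn : 1 ≤ n)
    [Fintype (G.EdgeLT n)] (L : ℕ) (f : G.Path → M) :
    ∑ u ∈ G.pathsOfLength (L + 1), f u = ∑ v ∈ G.pathsOfLength L, ∑ p : G.EdgeLT n,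
      if h : p.1.2 = Path.remLT n hn v then f (v.cons p.1.1 (rng_eq_of_snd_eq_remLT h)) else 0 := by
  rw [← Finset.sum_product']
  symm
  -- The prolonged path exists only for matching pairs, so the bijection is set up on nonvanishing
  -- terms, where a match is forced.
  have hc : ∀ x : G.Path × G.EdgeLT n, (if h : x.2.1.2 = Path.remLT n hn x.1 then
      f (x.1.cons x.2.1.1 (rng_eq_of_snd_eq_remLT h)) else 0) ≠ 0 →
      x.2.1.2 = Path.remLT n hn x.1 := fun x hx => by
    by_contra hcon
    rw [dif_neg hcon] at hx
    exact hx rfl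
  refine Finset.sum_bij_ne_zero (fun x _ h2 => x.1.cons x.2.1.1 (rng_eq_of_snd_eq_remLT (hc x h2)))
    ?_ ?_ ?_ ?_
  · intro x h1 h2
    rw [Finset.mem_product, mem_pathsOfLength] at h1
    rw [mem_pathsOfLength, Path.length_cons, h1.1]
  · intro x h1 h2 y h3 h4 hxy
    obtain ⟨h5, h6⟩ := Path.cons_inj hxy
    refine Prod.ext h6 (Subtype.ext (Prod.ext h5 ?_))
    rw [hc x h2, hc y h4, h6]
  · intro u hu hf
    obtain ⟨e, v, h, rfl⟩ := Path.exists_eq_cons (mem_pathsOfLength.1 hu)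
    refine ⟨(v, ⟨(e, Path.remLT n hn v), h⟩), ?_, ?_, rfl⟩
    · simpa [mem_pathsOfLength, Path.length_cons] using hu
    · simpa using hf
  · intro x h1 h2
    rw [dif_pos (hc x h2)]

end Levels

/-! ## The elements `S_u` of a Cuntz-Krieger `E(n)`-family -/

section PathElem

variable {B : Type*} {n : ℕ}

/-- The product of the partial isometries along the path of `E(n)` that starts at the trivial path
at the source of `u` and walks along the edges of `u`. -/
def pathElemAux [Mul B] (hn : 1 ≤ n) (P : G.PathLT n → B) (S : G.EdgeLT n → B) :
    ∀ (y : V) (l : List E), G.IsPath y l → B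
  | y, [], _ => P ⟨Path.vertex G y, hn⟩
  | _, e :: l, h => S ⟨(e, Path.remLT n hn ⟨G.s e, l, h.2⟩), rfl⟩ *
    pathElemAux hn P S (G.s e) l h.2

/-- The product of the partial isometries along the path of `E(n)` that starts at the trivial path
at the source of `u` and walks along the edges of `u`. -/
def pathElem [Mul B] (hn : 1 ≤ n) (P : G.PathLT n → B) (S : G.EdgeLT n → B) (u : G.Path) : B :=
  pathElemAux hn P S u.rng u.edges u.isPath

theorem pathElem_vertex [Mul B] (hn : 1 ≤ n) (P : G.PathLT n → B) (S : G.EdgeLT n → B) (x : V) :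
    pathElem hn P S (Path.vertex G x) = P ⟨Path.vertex G x, hn⟩ := rfl

/-- The match between p and w is a hypothesis, so that p can be the summation variable of
`sum_pathsOfLength_succ`. -/
theorem pathElem_cons [Mul B] (hn : 1 ≤ n) (P : G.PathLT n → B) (S : G.EdgeLT n → B)
    (p : G.EdgeLT n) (w : G.Path) (hp : p.1.2 = Path.remLT n hn w) (h : G.s p.1.1 = w.rng) :
    pathElem hn P S (w.cons p.1.1 h) = S p * pathElem hn P S w := by
  obtain ⟨⟨e, v⟩, he⟩ := p
  obtain ⟨x, l, hw⟩ := w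
  dsimp only at hp h
  subst hp h
  rfl

variable [Finite E] [Finite V] [NonUnitalRing B] [StarRing B] (hn : 1 ≤ n) {P : G.PathLT n → B}
  {S : G.EdgeLT n → B} (h : (G.pathGraph n).IsCKFamily P S)

include h

/-- The walk in E(n) along the edges of u ends at the vertex u(n). -/
theorem P_mul_pathElem (u : G.Path) :
    P (Path.remLT n hn u) * pathElem hn P S u = pathElem hn P S u := by
  rcases Nat.eq_zero_or_eq_succ_pred u.length with hu | hu
  · rw [Path.eq_vertex_of_length_eq_zero hu, pathElem_vertex,
      show Path.remLT n hn (Path.vertex G u.rng) = ⟨Path.vertex G u.rng, hn⟩ from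
        Path.remLT_val n hn ⟨Path.vertex G u.rng, hn⟩]
    exact (h.projection _).isIdempotentElem
  · obtain ⟨e, v, he, rfl⟩ := Path.exists_eq_cons hu
    let p : G.EdgeLT n := ⟨(e, Path.remLT n hn v), he⟩
    rw [pathElem_cons hn P S p v rfl he, Path.remLT_cons hn p v rfl he, ← mul_assoc, h.P_mul_S]

theorem P_mul_pathElem_of_ne {w : G.PathLT n} {u : G.Path} (hw : w ≠ Path.remLT n hn u) :
    P w * pathElem hn P S u = 0 := by
  rw [← P_mul_pathElem hn h, ← mul_assoc, h.orthogonal _ _ hw, zero_mul]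

theorem S_mul_pathElem_of_ne {p : G.EdgeLT n} {u : G.Path} (hp : p.1.2 ≠ Path.remLT n hn u) :
    S p * pathElem hn P S u = 0 := by
  rw [← h.S_mul_P, mul_assoc]
  have : P ((G.pathGraph n).s p) * pathElem hn P S u = 0 := P_mul_pathElem_of_ne hn h hp
  rw [this, mul_zero]

/-- Summing over all p is harmless: S_p S_u = 0 unless p can follow u. -/
theorem sum_pathElem_succ [Fintype (G.EdgeLT n)] (L : ℕ) :
    ∑ u ∈ G.pathsOfLength (L + 1), pathElem hn P S u * star (pathElem hn P S u) =
      ∑ p, S p * (∑ u ∈ G.pathsOfLength L, pathElem hn P S u * star (pathElem hn P S u)) *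
        star (S p) := by
  classical
  rw [sum_pathsOfLength_succ hn, Finset.sum_comm]
  refine Finset.sum_congr rfl fun p _ => ?_
  rw [Finset.mul_sum, Finset.sum_mul]
  refine Finset.sum_congr rfl fun u _ => ?_
  split_ifs with hp
  · rw [pathElem_cons hn P S p u hp, star_mul]
    noncomm_ring
  · rw [← mul_assoc (S p), S_mul_pathElem_of_ne hn h hp, zero_mul, zero_mul]

-- Induction on L. Conjugating the projection of level L by S_p yields S_p S_p^* if the source of p
-- has length L mod n, and 0 otherwise. That condition says that the range of p has length (L + 1)
-- mod n, and since E(n) has no sources the S_p S_p^* reassemble to the corresponding P_w.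
open Classical in
theorem sum_pathElem (hG : G.NoSources) [Fintype (G.PathLT n)] (L : ℕ) :
    ∑ u ∈ G.pathsOfLength L, pathElem hn P S u * star (pathElem hn P S u) =
      ∑ w : G.PathLT n with w.1.length = L % n, P w := by
  have := Fintype.ofFinite (G.EdgeLT n)
  induction L with
  | zero =>
    refine Finset.sum_bij (fun u hu => ⟨u, by
      rw [mem_pathsOfLength.1 hu]; exact hn⟩) ?_ ?_ ?_ ?_
    · intro u hu
      refine Finset.mem_filter.2 ⟨Finset.mem_univ _, ?_⟩
      rw [Nat.zero_mod]
      exact mem_pathsOfLength.1 hu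
    · intro u _ v _ huv
      simpa using huv
    · rintro ⟨w, hw⟩ h0
      have h1 := (Finset.mem_filter.1 h0).2
      rw [Nat.zero_mod] at h1
      exact ⟨w, mem_pathsOfLength.2 h1, rfl⟩
    · intro u hu
      have hu' := Path.eq_vertex_of_length_eq_zero (mem_pathsOfLength.1 hu)
      have h1 : pathElem hn P S u = P ⟨u, by rw [mem_pathsOfLength.1 hu]; exact hn⟩ := by
        conv_lhs => rw [hu', pathElem_vertex]
        congr 1
        exact Subtype.ext hu'.symm
      rw [h1, h.star_P, (h.projection _).isIdempotentElem]
  | succ L ih =>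
    rw [sum_pathElem_succ hn h, ih]
    have h1 : ∀ p : G.EdgeLT n,
        S p * (∑ w : G.PathLT n with w.1.length = L % n, P w) * star (S p) =
        if p.1.2.1.length = L % n then S p * star (S p) else 0 := by
      intro p
      rw [← h.S_mul_P p, mul_assoc (S p), Finset.mul_sum, Finset.sum_filter,
        Finset.sum_eq_single p.1.2]
      · split_ifs with hp
        · rw [show P ((G.pathGraph n).s p) * P p.1.2 = P ((G.pathGraph n).s p) from
            (h.projection _).isIdempotentElem, h.S_mul_P]
        · simp
      · intro w _ hw
        rw [show P ((G.pathGraph n).s p) * P w = 0 from h.orthogonal _ _ hw.symm, ite_self]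
      · simp
    -- Lengths of vertices of E(n) are below n, so they are determined by their residues and adding
    -- one can be cancelled modulo n.
    have h2 : ∀ p : G.EdgeLT n, p.1.2.1.length = L % n ↔
        ((G.pathGraph n).r p).1.length = (L + 1) % n := by
      intro p
      rw [length_pathGraph_r hn]
      have h3 := p.1.2.2
      constructor
      · intro h4
        rw [h4, Nat.mod_add_mod]
      · intro h4
        have h5 : p.1.2.1.length + 1 ≡ L + 1 [MOD n] := h4
        have h6 : p.1.2.1.length % n = L % n := Nat.ModEq.add_right_cancel' 1 h5
        rwa [Nat.mod_eq_of_lt h3] at h6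
    simp only [h1, h2]
    have h7 : ∀ w : G.PathLT n, P w =
        ∑ p : G.EdgeLT n with (G.pathGraph n).r p = w, S p * star (S p) := by
      intro w
      rw [← h.sum_range w (noSources_pathGraph hG hn w),
        finsum_mem_eq_finite_toFinset_sum _ (Set.toFinite _)]
      refine Finset.sum_congr ?_ fun _ _ => rfl
      ext p
      simp
    simp only [h7]
    rw [← Finset.sum_filter]
    rw [Finset.sum_fiberwise_eq_sum_filter]
    refine Finset.sum_congr ?_ fun _ _ => rfl
    ext p
    simp only [Finset.mem_filter, Finset.mem_univ, true_and]

end PathElem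

/-! ## Coordinates of the operators `T_{(e,w)}` -/

section Coordinates

variable {n : ℕ} (hn : 1 ≤ n)

theorem xi_eq_ell2Basis (w : G.Path) : G.xi w = ell2Basis w := rfl

include hn in
theorem opT_ell2Basis_of_eq (p : G.EdgeLT n) (w : G.Path) (hp : p.1.2 = Path.remLT n hn w) :
    G.opT n p (ell2Basis w) = ell2Basis (w.cons p.1.1 (rng_eq_of_snd_eq_remLT hp)) := by
  rw [← xi_eq_ell2Basis, opT_xi_of_eq G n p w (congrArg Subtype.val hp).symm]
  rfl

include hn in
theorem opT_ell2Basis_of_ne (p : G.EdgeLT n) (w : G.Path) (hp : p.1.2 ≠ Path.remLT n hn w) :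
    G.opT n p (ell2Basis w) = 0 :=
  opT_xi_of_ne G n p w fun h => hp (Subtype.ext h.symm)

-- Every path of positive length is a prolongation along exactly one edge p' of E(n), so this gives
-- all coordinates of T_p y except those at vertices, which vanish.
open Classical in
theorem opT_apply_cons (p p' : G.EdgeLT n) (w : G.Path) (hp' : p'.1.2 = Path.remLT n hn w)
    (y : G.FockSpace) :
    G.opT n p y (w.cons p'.1.1 (rng_eq_of_snd_eq_remLT hp')) = if p' = p then y w else 0 := by
  have h := star_clm_apply (star (G.opT n p)) y (w.cons p'.1.1 (rng_eq_of_snd_eq_remLT hp'))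
  rw [star_star] at h
  rw [h]
  have key : (star (G.opT n p)) (ell2Basis (w.cons p'.1.1 (rng_eq_of_snd_eq_remLT hp'))) =
      if p' = p then ell2Basis w else 0 := by
    ext u
    rw [star_clm_apply]
    by_cases hu : p.1.2 = Path.remLT n hn u
    · rw [opT_ell2Basis_of_eq hn p u hu, inner_ell2Basis_left, ell2Basis_apply]
      by_cases hpp : p' = p
      · subst hpp
        rw [if_pos rfl, ell2Basis_apply]
        congr 1
        refine propext ⟨fun hc => (Path.cons_inj hc).2, ?_⟩
        rintro rfl
        rfl
      · rw [if_neg hpp, if_neg]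
        · rfl
        · intro hc
          obtain ⟨h1, h2⟩ := Path.cons_inj hc
          exact hpp (Subtype.ext (Prod.ext h1.symm (by rw [hp', hu, h2])))
    · rw [opT_ell2Basis_of_ne hn p u hu, inner_zero_left]
      split_ifs with hpp
      · rw [ell2Basis_apply, if_neg]
        rintro rfl
        exact hu (hpp ▸ hp')
      · rfl
  rw [key]
  split_ifs
  · exact inner_ell2Basis_left _ _
  · exact inner_zero_left _

theorem star_opT_apply (p : G.EdgeLT n) (w : G.Path) (y : G.FockSpace)
    (hp : p.1.2 = Path.remLT n hn w) :
    star (G.opT n p) y w = y (w.cons p.1.1 (rng_eq_of_snd_eq_remLT hp)) := by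
  rw [star_clm_apply, opT_ell2Basis_of_eq hn p w hp, inner_ell2Basis_left]

theorem star_opT_apply_of_ne (p : G.EdgeLT n) (w : G.Path) (y : G.FockSpace)
    (hp : p.1.2 ≠ Path.remLT n hn w) : star (G.opT n p) y w = 0 := by
  rw [star_clm_apply, opT_ell2Basis_of_ne hn p w hp, inner_zero_left]

end Coordinates

/-! ## Asymptotic compression to the Cuntz-Krieger family -/

section Compression

variable [Finite V] [Finite E] {B : Type*} [NonUnitalCStarAlgebra B] {n : ℕ} (hn : 1 ≤ n)
  (P : G.PathLT n → B) (S : G.EdgeLT n → B)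

/-- The element `∑ y(u) S_u`, the sum over all paths `u` of length `L`. -/
def levelSum (L : ℕ) (y : G.FockSpace) : B := ∑ u ∈ G.pathsOfLength L, y u • pathElem hn P S u

/-- The averaged compression `N⁻¹ ∑ ⟨T ξ_v, ξ_u⟩ S_u S_v^*` of an operator on `ℓ²(E^*)`, the sum
over all paths of length in `[n N, 2 n N)`. -/
def compression (N : ℕ) : G.FockOp →ₗ[ℂ] B where
  toFun T := (N : ℂ)⁻¹ • ∑ u ∈ G.pathsIco (n * N) (n * (N + N)),
    ∑ v ∈ G.pathsIco (n * N) (n * (N + N)),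
      T (ell2Basis v) u • (pathElem hn P S u * star (pathElem hn P S v))
  map_add' T T' := by
    rw [← smul_add, ← Finset.sum_add_distrib]
    congr 1
    refine Finset.sum_congr rfl fun u _ => ?_
    rw [← Finset.sum_add_distrib]
    refine Finset.sum_congr rfl fun v _ => ?_
    rw [← add_smul]
    rfl
  map_smul' c T := by
    rw [RingHom.id_apply, smul_comm c, Finset.smul_sum (r := c)]
    congr 1
    refine Finset.sum_congr rfl fun u _ => ?_
    rw [Finset.smul_sum]
    refine Finset.sum_congr rfl fun v _ => ?_
    rw [smul_smul]
    rfl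

variable {P S}

theorem compression_eq_sum_entries (N : ℕ) (T : G.FockOp) :
    compression hn P S N T = (N : ℂ)⁻¹ • ∑ u ∈ G.pathsIco (n * N) (n * (N + N)),
      ∑ v ∈ G.pathsIco (n * N) (n * (N + N)),
        T (ell2Basis v) u • (pathElem hn P S u * star (pathElem hn P S v)) := rfl

/-- Grouped by columns and levels: left multiplication of T by an operator now acts only on the
arguments of `levelSum`. -/
theorem compression_apply (N : ℕ) (T : G.FockOp) :
    compression hn P S N T = (N : ℂ)⁻¹ • ∑ v ∈ G.pathsIco (n * N) (n * (N + N)),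
      (∑ L ∈ Finset.Ico (n * N) (n * (N + N)), levelSum hn P S L (T (ell2Basis v))) *
        star (pathElem hn P S v) := by
  rw [compression_eq_sum_entries]
  congr 1
  rw [Finset.sum_comm]
  refine Finset.sum_congr rfl fun v _ => ?_
  rw [sum_pathsIco, Finset.sum_mul]
  refine Finset.sum_congr rfl fun L _ => ?_
  rw [levelSum, Finset.sum_mul]
  simp only [smul_mul_assoc]

variable (h : (G.pathGraph n).IsCKFamily P S)

include h

/-- The coefficient of T_p y at the prolongation of v by p is y(v), and S_p S_v is the path element
of that prolongation; where p does not match v, S_p S_v = 0. -/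
theorem levelSum_opT (p : G.EdgeLT n) (L : ℕ) (y : G.FockSpace) :
    levelSum hn P S (L + 1) (G.opT n p y) = S p * levelSum hn P S L y := by
  classical
  have := Fintype.ofFinite (G.EdgeLT n)
  rw [levelSum, sum_pathsOfLength_succ hn, levelSum, Finset.mul_sum]
  refine Finset.sum_congr rfl fun v _ => ?_
  rw [Finset.sum_eq_single p]
  · split_ifs with hp
    · rw [opT_apply_cons hn p p v hp, if_pos rfl, pathElem_cons hn P S p v hp, mul_smul_comm]
    · rw [mul_smul_comm, S_mul_pathElem_of_ne hn h hp, smul_zero]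
  · intro p' _ hpp
    split_ifs with hp'
    · rw [opT_apply_cons hn p p' v hp', if_neg hpp, zero_smul]
    · rfl
  · simp

/-- S_p^* annihilates path elements whose last edge is not p, and strips p from the others because
S_p^* S_p = P_{v(n)} fixes S_v. -/
theorem levelSum_star_opT (p : G.EdgeLT n) (L : ℕ) (y : G.FockSpace) :
    levelSum hn P S L (star (G.opT n p) y) = star (S p) * levelSum hn P S (L + 1) y := by
  classical
  have := Fintype.ofFinite (G.EdgeLT n)
  rw [levelSum, levelSum, sum_pathsOfLength_succ hn, Finset.mul_sum]
  refine Finset.sum_congr rfl fun v _ => ?_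
  rw [Finset.mul_sum, Finset.sum_eq_single p]
  · split_ifs with hp
    · rw [star_opT_apply hn p v y hp, pathElem_cons hn P S p v hp, mul_smul_comm, ← mul_assoc,
        h.star_mul_self]
      congr 1
      have := P_mul_pathElem hn h v
      rw [← hp] at this
      exact this.symm
    · rw [star_opT_apply_of_ne hn p v y hp, zero_smul, mul_zero]
  · intro p' _ hpp
    split_ifs with hp'
    · rw [pathElem_cons hn P S p' v hp', mul_smul_comm, ← mul_assoc,
        h.star_mul_of_ne _ _ hpp.symm, zero_mul, smul_zero]
    · rw [mul_zero]
  · simp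

variable (hG : G.NoSources) [Fintype (G.PathLT n)]
include hG

omit [Fintype (G.PathLT n)] in
theorem norm_sum_pathElem_le (L : ℕ) :
    ‖∑ u ∈ G.pathsOfLength L, pathElem hn P S u * star (pathElem hn P S u)‖ ≤ 1 := by
  classical
  have := Fintype.ofFinite (G.PathLT n)
  rw [sum_pathElem hn h hG]
  exact IsStarProjection.norm_le _ (h.isStarProjection_sum _)

/-- A block of n consecutive levels meets each residue modulo n, thus each possible length of a
vertex of E(n), exactly once. -/
theorem sum_pathElem_period (a : ℕ) :
    ∑ L ∈ Finset.Ico (n * a) (n * (a + 1)),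
      ∑ u ∈ G.pathsOfLength L, pathElem hn P S u * star (pathElem hn P S u) = ∑ w, P w := by
  classical
  rw [Finset.sum_Ico_eq_sum_range, show n * (a + 1) - n * a = n by
    rw [mul_add, mul_one, Nat.add_sub_cancel_left]]
  have h1 : ∀ k ∈ Finset.range n, ∑ u ∈ G.pathsOfLength (n * a + k),
      pathElem hn P S u * star (pathElem hn P S u) =
      ∑ w : G.PathLT n with w.1.length = k, P w := by
    intro k hk
    rw [sum_pathElem hn h hG, Nat.mul_add_mod, Nat.mod_eq_of_lt (Finset.mem_range.1 hk)]
  rw [Finset.sum_congr rfl h1]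
  exact Finset.sum_fiberwise_of_maps_to (fun w _ => Finset.mem_range.2 w.2) _

theorem sum_pathElem_pathsIco (a N : ℕ) :
    ∑ u ∈ G.pathsIco (n * a) (n * (a + N)), pathElem hn P S u * star (pathElem hn P S u) =
      N • ∑ w, P w := by
  rw [sum_pathsIco]
  induction N with
  | zero => simp
  | succ N ih =>
    rw [← add_assoc, ← Finset.sum_Ico_consecutive _ (Nat.mul_le_mul_left n (Nat.le_add_right a N))
      (Nat.mul_le_mul_left n (Nat.le_add_right (a + N) 1)), ih,
      sum_pathElem_period hn h hG, succ_nsmul]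

omit [Fintype (G.PathLT n)] in
theorem norm_sum_pathElem_pathsIco_le (a N : ℕ) :
    ‖∑ u ∈ G.pathsIco (n * a) (n * (a + N)), pathElem hn P S u * star (pathElem hn P S u)‖ ≤ N := by
  have := Fintype.ofFinite (G.PathLT n)
  rw [sum_pathElem_pathsIco hn h hG]
  refine (norm_nsmul_le).trans ?_
  exact mul_le_of_le_one_right (Nat.cast_nonneg N)
    (IsStarProjection.norm_le _ (h.isStarProjection_sum _))

-- The rows on both sides have norm at most √N, which the averaging factor N⁻¹ compensates.
omit [Fintype (G.PathLT n)] in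
theorem norm_compression_le (N : ℕ) (T : G.FockOp) : ‖compression hn P S N T‖ ≤ ‖T‖ := by
  rcases N.eq_zero_or_pos with rfl | hN
  · have : compression hn P S 0 T = 0 := by
      rw [compression_apply]; simp
    rw [this, norm_zero]
    exact norm_nonneg T
  have hN' : (0 : ℝ) < N := Nat.cast_pos.2 hN
  rw [compression_eq_sum_entries, norm_smul, norm_inv, Complex.norm_natCast, inv_mul_le_iff₀ hN']
  refine (norm_sum_entries_smul_le T _ _ _ _).trans ?_
  rw [mul_assoc, Real.mul_self_sqrt (norm_nonneg _), mul_comm]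
  gcongr
  exact norm_sum_pathElem_pathsIco_le hn h hG N N

/-- There is no error term because the window consists of exactly N full periods. -/
theorem compression_one {N : ℕ} (hN : 0 < N) : compression hn P S N 1 = ∑ w, P w := by
  classical
  rw [compression_eq_sum_entries]
  have h1 : ∀ u ∈ G.pathsIco (n * N) (n * (N + N)), (∑ v ∈ G.pathsIco (n * N) (n * (N + N)),
      ((1 : G.FockOp) (ell2Basis v)) u • (pathElem hn P S u * star (pathElem hn P S v))) =
      pathElem hn P S u * star (pathElem hn P S u) := by
    intro u hu
    rw [Finset.sum_eq_single u]
    · rw [one_apply_eq_self, ell2Basis_apply, if_pos rfl, one_smul]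
    · intro v _ hv
      rw [one_apply_eq_self, ell2Basis_apply, if_neg hv.symm, zero_smul]
    · exact fun hu' => absurd hu hu'
  rw [Finset.sum_congr rfl h1, sum_pathElem_pathsIco hn h hG, ← Nat.cast_smul_eq_nsmul ℂ,
    inv_smul_smul₀ (Nat.cast_ne_zero.2 hN.ne')]

-- The row over a single level has norm at most 1, so only the columns contribute √N. This gain over
-- N makes boundary levels negligible after averaging.
omit [Fintype (G.PathLT n)] in
theorem norm_sum_levelSum_mul_le (N L : ℕ) (Y : G.FockOp) :
    ‖∑ v ∈ G.pathsIco (n * N) (n * (N + N)),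
      levelSum hn P S L (Y (ell2Basis v)) * star (pathElem hn P S v)‖ ≤ ‖Y‖ * √N := by
  have h1 : ∑ v ∈ G.pathsIco (n * N) (n * (N + N)),
      levelSum hn P S L (Y (ell2Basis v)) * star (pathElem hn P S v) =
      ∑ u ∈ G.pathsOfLength L, ∑ v ∈ G.pathsIco (n * N) (n * (N + N)),
        Y (ell2Basis v) u • (pathElem hn P S u * star (pathElem hn P S v)) := by
    rw [Finset.sum_comm]
    refine Finset.sum_congr rfl fun v _ => ?_
    rw [levelSum, Finset.sum_mul]
    simp only [smul_mul_assoc]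
  rw [h1]
  refine (norm_sum_entries_smul_le Y _ _ _ _).trans ?_
  refine mul_le_mul ?_ (Real.sqrt_le_sqrt (norm_sum_pathElem_pathsIco_le hn h hG N N))
    (Real.sqrt_nonneg _) (norm_nonneg _)
  refine mul_le_of_le_one_right (norm_nonneg _) ?_
  exact Real.sqrt_le_one.2 (norm_sum_pathElem_le hn h hG L)

omit [Fintype (G.PathLT n)] in
/-- If `X` moves levels by one with coefficient `b`, then compression intertwines `X` and `b` up to
boundary terms. -/
theorem norm_compression_mul_sub_le {X Y : G.FockOp} {b : B} {N L L' : ℕ}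
    (hX : ∀ y, ∑ l ∈ Finset.Ico (n * N) (n * (N + N)), levelSum hn P S l (X y) =
      b * (∑ l ∈ Finset.Ico (n * N) (n * (N + N)), levelSum hn P S l y +
        (levelSum hn P S L y - levelSum hn P S L' y))) :
    ‖compression hn P S N (X * Y) - b * compression hn P S N Y‖ ≤
      (N : ℝ)⁻¹ * (‖b‖ * (‖Y‖ * √N + ‖Y‖ * √N)) := by
  have h1 : compression hn P S N (X * Y) - b * compression hn P S N Y = (N : ℂ)⁻¹ • (b *
      (∑ v ∈ G.pathsIco (n * N) (n * (N + N)),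
        levelSum hn P S L (Y (ell2Basis v)) * star (pathElem hn P S v) -
      ∑ v ∈ G.pathsIco (n * N) (n * (N + N)),
        levelSum hn P S L' (Y (ell2Basis v)) * star (pathElem hn P S v))) := by
    rw [compression_apply, compression_apply, mul_smul_comm, ← smul_sub]
    congr 1
    rw [Finset.mul_sum, ← Finset.sum_sub_distrib, ← Finset.sum_sub_distrib, Finset.mul_sum]
    refine Finset.sum_congr rfl fun v _ => ?_
    rw [mul_apply_eq_comp, hX]
    noncomm_ring
  rw [h1, norm_smul, norm_inv, Complex.norm_natCast]
  refine mul_le_mul_of_nonneg_left ((norm_mul_le _ _).trans (mul_le_mul_of_nonneg_left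
    ((norm_sub_le _ _).trans (add_le_add ?_ ?_)) (norm_nonneg _))) (by positivity)
  · exact norm_sum_levelSum_mul_le hn h hG N L Y
  · exact norm_sum_levelSum_mul_le hn h hG N L' Y

-- The boundary error is at most 2‖b‖‖Y‖/√N, whichever levels L and L' are chosen for each N.
omit [Fintype (G.PathLT n)] in
theorem tendsto_compression_mul_sub {X Y : G.FockOp} {b : B}
    (hX : ∀ N > 0, ∃ L L', ∀ y, ∑ l ∈ Finset.Ico (n * N) (n * (N + N)), levelSum hn P S l (X y) =
      b * (∑ l ∈ Finset.Ico (n * N) (n * (N + N)), levelSum hn P S l y +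
        (levelSum hn P S L y - levelSum hn P S L' y))) :
    Tendsto (fun N => compression hn P S N (X * Y) - b * compression hn P S N Y) atTop (𝓝 0) := by
  have hlim : Tendsto (fun N : ℕ => (2 * ‖b‖ * ‖Y‖) * (√(N : ℝ))⁻¹) atTop (𝓝 0) := by
    have := (Real.tendsto_sqrt_atTop.comp
      (tendsto_natCast_atTop_atTop (R := ℝ))).inv_tendsto_atTop.const_mul (2 * ‖b‖ * ‖Y‖)
    simpa using this
  refine squeeze_zero_norm' ?_ hlim
  filter_upwards [eventually_gt_atTop 0] with N hN
  obtain ⟨L, L', hLL⟩ := hX N hN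
  refine (norm_compression_mul_sub_le hn h hG (Y := Y) hLL).trans_eq ?_
  have hs : √(N : ℝ) * √N = N := Real.mul_self_sqrt (Nat.cast_nonneg N)
  have hs0 : √(N : ℝ) ≠ 0 := (Real.sqrt_pos.2 (Nat.cast_pos.2 hN)).ne'
  rw [show (N : ℝ)⁻¹ = (√(N : ℝ))⁻¹ * (√(N : ℝ))⁻¹ by rw [← mul_inv, hs]]
  field_simp
  ring

omit [Fintype (G.PathLT n)] in
theorem tendsto_compression_opT_mul_sub (p : G.EdgeLT n) (Y : G.FockOp) :
    Tendsto (fun N => compression hn P S N (G.opT n p * Y) - S p * compression hn P S N Y)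
      atTop (𝓝 0) := by
  -- Pulling the window back by one level gains level nN - 1 and loses level 2nN - 1; both
  -- subtractions are genuine since nN > 0.
  refine tendsto_compression_mul_sub hn h hG fun N hN =>
    ⟨n * N - 1, n * (N + N) - 1, fun y => ?_⟩
  obtain ⟨a, ha⟩ := Nat.exists_eq_add_of_lt (Nat.mul_pos hn hN)
  obtain ⟨b, hb⟩ := Nat.exists_eq_add_of_lt (Nat.mul_pos hn (Nat.add_pos_left hN N))
  have hab : a ≤ b := by
    have : n * N ≤ n * (N + N) := Nat.mul_le_mul_left n (Nat.le_add_right N N)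
    omega
  rw [ha, hb]
  simp only [zero_add, Nat.add_sub_cancel]
  rw [← Finset.sum_Ico_add' (fun l => levelSum hn P S l (G.opT n p y)) a b 1]
  simp only [levelSum_opT hn h]
  rw [← Finset.mul_sum]
  congr 1
  have h1 := Finset.sum_Ico_succ_top hab fun l => levelSum hn P S l y
  have h2 := Finset.sum_eq_sum_Ico_succ_bot (Nat.lt_succ_of_le hab) fun l => levelSum hn P S l y
  rw [Nat.succ_eq_add_one, h1] at h2
  rw [eq_sub_of_add_eq h2]
  abel

omit [Fintype (G.PathLT n)] in
theorem tendsto_compression_star_opT_mul_sub (p : G.EdgeLT n) (Y : G.FockOp) :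
    Tendsto (fun N => compression hn P S N (star (G.opT n p) * Y) -
      star (S p) * compression hn P S N Y) atTop (𝓝 0) := by
  -- The adjoint moves the window up by one: level 2nN is gained and level nN is lost.
  refine tendsto_compression_mul_sub hn h hG fun N hN =>
    ⟨n * (N + N), n * N, fun y => ?_⟩
  have hab : n * N ≤ n * (N + N) := Nat.mul_le_mul_left n (Nat.le_add_right N N)
  simp only [levelSum_star_opT hn h]
  rw [← Finset.mul_sum, Finset.sum_Ico_add' (fun l => levelSum hn P S l y) _ _ 1]
  congr 1
  have h1 := Finset.sum_Ico_succ_top hab fun l => levelSum hn P S l y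
  have h2 := Finset.sum_eq_sum_Ico_succ_bot (Nat.lt_succ_of_le hab) fun l => levelSum hn P S l y
  rw [Nat.succ_eq_add_one, h1] at h2
  rw [← sub_eq_of_eq_add' h2]
  abel

-- Approximate K by pK with p a finite coordinate projection. Once N exceeds the lengths of the
-- paths belonging to p, no row of pK meets the window; contractivity controls K - pK.
omit [Fintype (G.PathLT n)] in
theorem tendsto_compression_of_isCompactOperator {K : G.FockOp} (hK : IsCompactOperator K) :
    Tendsto (fun N => compression hn P S N K) atTop (𝓝 0) := by
  rw [Metric.tendsto_nhds]
  intro ε hε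
  obtain ⟨F, hF⟩ := ((Metric.tendsto_nhds.1 (tendsto_finProj_mul hK)) ε hε).exists
  filter_upwards [eventually_gt_atTop (F.sup Path.length)] with N hN
  have h0 : compression hn P S N (finProj F * K) = 0 := by
    rw [compression_eq_sum_entries]
    rw [Finset.sum_eq_zero, smul_zero]
    intro u hu
    refine Finset.sum_eq_zero fun v _ => ?_
    have huF : u ∉ (F : Set G.Path) := by
      intro huF
      have h1 := Finset.le_sup (f := Path.length) huF
      have h2 := le_length_of_mem_pathsIco hu
      have h3 : 1 * N ≤ n * N := Nat.mul_le_mul_right N hn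
      omega
    rw [mul_apply_eq_comp, finProj, partialShift_ofSet_apply, if_neg huF, zero_smul]
  have h1 : compression hn P S N K = compression hn P S N (K - finProj F * K) := by
    rw [map_sub, h0, sub_zero]
  rw [dist_zero_right, h1]
  refine (norm_compression_le hn h hG N _).trans_lt ?_
  rwa [dist_eq_norm'] at hF

end Compression

end DirectedGraph

/-! ### C⋆-algebras generated by a set. -/

theorem subset_cstarGenerated {A : Type*} [NonUnitalCStarAlgebra A] (X : Set A) :
    X ⊆ cstarGenerated X :=
  fun _ hx => NonUnitalStarSubalgebra.le_topologicalClosure _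
    (NonUnitalStarAlgebra.subset_adjoin ℂ _ hx)

theorem isClosed_cstarGenerated {A : Type*} [NonUnitalCStarAlgebra A] (X : Set A) :
    IsClosed (cstarGenerated X : Set A) :=
  NonUnitalStarSubalgebra.isClosed_topologicalClosure _

theorem cstarGenerated_le {A : Type*} [NonUnitalCStarAlgebra A] {X : Set A}
    {D : NonUnitalStarSubalgebra ℂ A} (hD : IsClosed (D : Set A)) (hX : X ⊆ D) :
    cstarGenerated X ≤ D :=
  NonUnitalStarSubalgebra.topologicalClosure_minimal _ (NonUnitalStarAlgebra.adjoin_le hX) hD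

namespace DirectedGraph

variable {V E : Type u} {G : DirectedGraph V E}

/-! ## Elements that are compressed to a prescribed element -/

section Compression

variable [Finite V] [Finite E] {B : Type*} [NonUnitalCStarAlgebra B] {n : ℕ} (hn : 1 ≤ n)
  (P : G.PathLT n → B) (S : G.EdgeLT n → B) [Fintype (G.PathLT n)]

/-- The averaged compressions are asymptotically multiplicative at `T` and `T^*`, and map them
asymptotically to `b` and `b^*`. -/
structure CompressesTo (T : G.FockOp) (b : B) : Prop where
  tendsto_mul : ∀ Y, Tendsto (fun N => compression hn P S N (T * Y) - b * compression hn P S N Y)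
    atTop (𝓝 0)
  tendsto_star_mul : ∀ Y, Tendsto (fun N => compression hn P S N (star T * Y) -
    star b * compression hn P S N Y) atTop (𝓝 0)
  mul_sum : b * ∑ w, P w = b
  star_mul_sum : star b * ∑ w, P w = star b

namespace CompressesTo

variable {hn P S} {T T' : G.FockOp} {b b' : B}

protected theorem star (h : CompressesTo hn P S T b) : CompressesTo hn P S (star T) (star b) where
  tendsto_mul := h.tendsto_star_mul
  tendsto_star_mul := by rw [star_star, star_star]; exact h.tendsto_mul
  mul_sum := h.star_mul_sum
  star_mul_sum := by rw [star_star]; exact h.mul_sum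

theorem tendsto_add_aux {A : Type*} [NonUnitalCStarAlgebra A] {f g f' g' : ℕ → A}
    (h1 : Tendsto (fun N => f N - g N) atTop (𝓝 0))
    (h2 : Tendsto (fun N => f' N - g' N) atTop (𝓝 0)) :
    Tendsto (fun N => f N + f' N - (g N + g' N)) atTop (𝓝 0) := by
  simpa [add_sub_add_comm] using h1.add h2

protected theorem add (h : CompressesTo hn P S T b) (h' : CompressesTo hn P S T' b') :
    CompressesTo hn P S (T + T') (b + b') where
  tendsto_mul Y := by
    simpa only [add_mul, map_add] using tendsto_add_aux (h.tendsto_mul Y) (h'.tendsto_mul Y)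
  tendsto_star_mul Y := by
    simpa only [star_add, add_mul, map_add] using
      tendsto_add_aux (h.tendsto_star_mul Y) (h'.tendsto_star_mul Y)
  mul_sum := by rw [add_mul, h.mul_sum, h'.mul_sum]
  star_mul_sum := by rw [star_add, add_mul, h.star_mul_sum, h'.star_mul_sum]

protected theorem smul (c : ℂ) (h : CompressesTo hn P S T b) :
    CompressesTo hn P S (c • T) (c • b) where
  tendsto_mul Y := by
    simpa only [smul_mul_assoc, map_smul, smul_sub, smul_zero] using (h.tendsto_mul Y).const_smul c
  tendsto_star_mul Y := by
    simpa only [star_smul, smul_mul_assoc, map_smul, smul_sub, smul_zero] using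
      (h.tendsto_star_mul Y).const_smul (star c)
  mul_sum := by rw [smul_mul_assoc, h.mul_sum]
  star_mul_sum := by rw [star_smul, smul_mul_assoc, h.star_mul_sum]

protected theorem zero : CompressesTo hn P S 0 0 where
  tendsto_mul Y := by simp
  tendsto_star_mul Y := by simp
  mul_sum := zero_mul _
  star_mul_sum := by rw [star_zero, zero_mul]

-- Φ_N(TT'Y) is close to bΦ_N(T'Y), hence to bb'Φ_N(Y). The first step uses T'Y as test operator,
-- which is why Y is arbitrary in `CompressesTo`.
omit [Fintype (G.PathLT n)] in
theorem tendsto_mul_mul_aux {T T' : G.FockOp} {b b' : B}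
    (h : ∀ Y, Tendsto (fun N => compression hn P S N (T * Y) - b * compression hn P S N Y)
      atTop (𝓝 0))
    (h' : ∀ Y, Tendsto (fun N => compression hn P S N (T' * Y) - b' * compression hn P S N Y)
      atTop (𝓝 0)) (Y : G.FockOp) :
    Tendsto (fun N => compression hn P S N (T * T' * Y) - b * b' * compression hn P S N Y)
      atTop (𝓝 0) := by
  have h1 := (h (T' * Y)).add ((h' Y).const_mul b)
  rw [mul_zero, add_zero] at h1
  refine h1.congr fun N => ?_
  rw [mul_sub, ← mul_assoc, ← mul_assoc, sub_add_sub_cancel]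

protected theorem mul (h : CompressesTo hn P S T b) (h' : CompressesTo hn P S T' b') :
    CompressesTo hn P S (T * T') (b * b') where
  tendsto_mul := tendsto_mul_mul_aux h.tendsto_mul h'.tendsto_mul
  tendsto_star_mul := by
    rw [star_mul, star_mul]
    exact tendsto_mul_mul_aux h'.tendsto_star_mul h.tendsto_star_mul
  mul_sum := by rw [mul_assoc, h'.mul_sum]
  star_mul_sum := by rw [star_mul, mul_assoc, h.star_mul_sum]

theorem of_opT (h : (G.pathGraph n).IsCKFamily P S) (hG : G.NoSources) (p : G.EdgeLT n) :
    CompressesTo hn P S (G.opT n p) (S p) where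
  tendsto_mul := tendsto_compression_opT_mul_sub hn h hG p
  tendsto_star_mul := tendsto_compression_star_opT_mul_sub hn h hG p
  mul_sum := h.S_mul_sum p
  star_mul_sum := h.star_S_mul_sum p

/-- The limit of the compressions is dominated by the essential norm. -/
theorem norm_le (hT : CompressesTo hn P S T b) (h : (G.pathGraph n).IsCKFamily P S)
    (hG : G.NoSources) : ‖b‖ ≤ ‖G.calkinMk T‖ := by
  -- Test with Y = 1: its compression is ∑ P_w, which b absorbs.
  have h1 : Tendsto (fun N => compression hn P S N T) atTop (𝓝 b) := by
    have h2 := (hT.tendsto_mul 1).add_const b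
    rw [zero_add] at h2
    refine h2.congr' ?_
    filter_upwards [eventually_gt_atTop 0] with N hN
    rw [compression_one hn h hG hN, hT.mul_sum, mul_one, sub_add_cancel]
  refine le_of_forall_pos_le_add fun ε hε => ?_
  obtain ⟨A, hA, hAn⟩ := compactIdeal.exists_cls_eq_norm_lt (G.calkinMk T) hε
  have hK := compactIdeal.cls_eq_cls_iff.1 hA.symm
  have h3 := h1.sub (tendsto_compression_of_isCompactOperator hn h hG hK)
  rw [sub_zero] at h3
  refine le_of_tendsto (h3.norm) (Eventually.of_forall fun N => ?_)
  rw [← map_sub, sub_sub_cancel]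
  exact (norm_compression_le hn h hG N A).trans hAn.le

end CompressesTo

end Compression

/-! ## The Cuntz-Krieger relations modulo the compact operators -/

section Relations

variable {n : ℕ} (hn : 1 ≤ n)

theorem opQ_apply (w : G.PathLT n) (y : G.FockSpace) (u : G.Path) [Decidable (u.rem n = w.1)] :
    G.opQ n w y u = if u.rem n = w.1 then y u else 0 := by
  rw [opQ, partialShift_apply, PEquiv.ofSet_symm]
  by_cases h : u.rem n = w.1 <;> simp [PEquiv.ofSet, h]

theorem opT_apply_of_length_eq_zero (p : G.EdgeLT n) (y : G.FockSpace) {u : G.Path}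
    (hu : u.length = 0) : G.opT n p y u = 0 := by
  rw [Path.eq_vertex_of_length_eq_zero hu]
  rfl

theorem opT_mul_opQ (p : G.EdgeLT n) : G.opT n p * G.opQ n p.1.2 = G.opT n p := by
  classical
  refine ell2_ext fun w => ?_
  change G.opT n p (G.opQ n p.1.2 (G.xi w)) = G.opT n p (G.xi w)
  rw [opQ_xi]
  split_ifs with h
  · rfl
  · rw [opT_xi_of_ne G n p w h, map_zero]

include hn

theorem star_opT_mul_opT_self (p : G.EdgeLT n) :
    star (G.opT n p) * G.opT n p = G.opQ n p.1.2 := by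
  classical
  refine ContinuousLinearMap.ext fun y => ?_
  ext u
  rw [mul_apply_eq_comp, opQ_apply]
  by_cases hp : p.1.2 = Path.remLT n hn u
  · rw [star_opT_apply hn p u _ hp, opT_apply_cons hn p p u hp, if_pos rfl,
      if_pos (show u.rem n = p.1.2.1 from (congrArg Subtype.val hp).symm)]
  · rw [star_opT_apply_of_ne hn p u _ hp, if_neg fun h => hp (Subtype.ext h.symm)]

theorem star_opT_mul_opT_of_ne {p p' : G.EdgeLT n} (hpp : p ≠ p') :
    star (G.opT n p) * G.opT n p' = 0 := by
  classical
  refine ContinuousLinearMap.ext fun y => ?_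
  ext u
  rw [mul_apply_eq_comp]
  by_cases hp : p.1.2 = Path.remLT n hn u
  · rw [star_opT_apply hn p u _ hp, opT_apply_cons hn p' p u hp, if_neg hpp]
    rfl
  · rw [star_opT_apply_of_ne hn p u _ hp]
    rfl

-- A path of positive length with remainder w arises by prolongation along exactly one edge of E(n)
-- with range w, so the range projections exhaust Q_w except at a trivial path. The defect is
-- compact, which yields the last Cuntz–Krieger relation, and it supplies the first rank-one
-- projections in A(n).
open Classical in
theorem opQ_sub_sum_opT_mul_star [Fintype (G.EdgeLT n)] (w : G.PathLT n) :
    G.opQ n w - ∑ p : G.EdgeLT n with (G.pathGraph n).r p = w, G.opT n p * star (G.opT n p) =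
      if w.1.length = 0 then matrixUnit w.1 w.1 else 0 := by
  refine ContinuousLinearMap.ext fun y => ?_
  ext u
  have hsum : ∀ s : Finset (G.EdgeLT n), (∑ p ∈ s, G.opT n p * star (G.opT n p)) y u =
      ∑ p ∈ s, G.opT n p (star (G.opT n p) y) u := by
    intro s
    rw [sum_apply, lp.coeFn_sum, Finset.sum_apply]
    rfl
  rw [sub_apply, lp.coeFn_sub, Pi.sub_apply, hsum, opQ_apply]
  rcases Nat.eq_zero_or_eq_succ_pred u.length with hu | hu
  · have hu' : u.rem n = u := Path.rem_of_length_lt (by omega)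
    rw [Finset.sum_eq_zero fun p _ => opT_apply_of_length_eq_zero p _ hu, sub_zero, hu']
    by_cases huw : u = w.1
    · rw [if_pos huw, ← huw, if_pos hu, matrixUnit_apply]
      simp [ell2Basis_apply]
    · rw [if_neg huw]
      split_ifs
      · rw [matrixUnit_apply]
        simp [ell2Basis_apply, huw]
      · rfl
  · obtain ⟨e, v, he, rfl⟩ := Path.exists_eq_cons hu
    let p' : G.EdgeLT n := ⟨(e, Path.remLT n hn v), he⟩
    have h1 : ∀ p : G.EdgeLT n, G.opT n p (star (G.opT n p) y) (v.cons e he) =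
        if p' = p then y (v.cons e he) else 0 := by
      intro p
      have := opT_apply_cons hn p p' v rfl (star (G.opT n p) y)
      refine this.trans ?_
      split_ifs with hpp
      · subst hpp
        exact star_opT_apply hn p' v y rfl
      · rfl
    have h2 : (v.cons e he).rem n = w.1 ↔ (G.pathGraph n).r p' = w := by
      rw [← Path.remLT_cons hn p' v rfl he]
      exact ⟨fun h => Subtype.ext h, fun h => congrArg Subtype.val h⟩
    simp only [h1, h2, Finset.sum_filter]
    rw [Finset.sum_eq_single p' (fun p _ hp => by rw [if_neg hp.symm, ite_self]) (by simp),
      if_pos rfl, sub_self]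
    split_ifs with h0
    · rw [matrixUnit_apply]
      have : v.cons e he ≠ w.1 := by
        intro h
        rw [← h] at h0
        exact Nat.succ_ne_zero _ h0
      simp [ell2Basis_apply, this]
    · rfl

end Relations

/-- The quotient map onto the Calkin algebra as a ⋆-homomorphism. -/
def calkinHom (G : DirectedGraph V E) : G.FockOp →⋆ₙₐ[ℂ] G.Calkin where
  toFun := G.calkinMk
  map_smul' _ _ := rfl
  map_zero' := rfl
  map_add' _ _ := rfl
  map_mul' _ _ := rfl
  map_star' _ := rfl

theorem calkinHom_apply (T : G.FockOp) : G.calkinHom T = G.calkinMk T := rfl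

theorem norm_calkinHom_le (T : G.FockOp) : ‖G.calkinHom T‖ ≤ ‖T‖ := compactIdeal.norm_cls_le T

theorem continuous_calkinHom : Continuous G.calkinHom :=
  AddMonoidHomClass.continuous_of_bound G.calkinHom 1 fun T => by
    rw [one_mul]; exact norm_calkinHom_le T

/-- All relations but the summation of range projections already hold for the operators themselves.
-/
theorem isCKFamily_calkin [Finite V] [Finite E] {n : ℕ} (hn : 1 ≤ n) :
    (G.pathGraph n).IsCKFamily (fun w => G.calkinMk (G.opQ n w))
      (fun p => G.calkinMk (G.opT n p)) := by
  classical
  have := Fintype.ofFinite (G.EdgeLT n)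
  simp only [← calkinHom_apply]
  refine ⟨fun w => ?_, fun p => ?_, fun w w' hw => ?_, fun p p' hp => ?_, fun p => ?_,
    fun w _ => ?_⟩
  · exact (isStarProjection_partialShift_ofSet _).map G.calkinHom
  · rw [← map_star, ← map_mul, ← map_mul, mul_assoc, star_opT_mul_opT_self hn, opT_mul_opQ]
  · rw [← map_mul]
    convert map_zero G.calkinHom
    refine ContinuousLinearMap.ext fun y => ?_
    ext u
    rw [mul_apply_eq_comp, opQ_apply, opQ_apply]
    split_ifs with h1 h2
    · exact absurd (Subtype.ext (h1.symm.trans h2)) hw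
    · rfl
    · rfl
  · rw [← map_star, ← map_mul, star_opT_mul_opT_of_ne hn hp, map_zero]
  · rw [← map_star, ← map_mul, star_opT_mul_opT_self hn]
    rfl
  · rw [finsum_mem_eq_finite_toFinset_sum _ (Set.toFinite _)]
    simp only [← map_star, ← map_mul]
    rw [← map_sum]
    symm
    refine compactIdeal.cls_eq_cls_iff.2 ?_
    have h1 := opQ_sub_sum_opT_mul_star hn w
    have h2 : (Set.toFinite {p : G.EdgeLT n | (G.pathGraph n).r p = w}).toFinset =
        Finset.univ.filter fun p : G.EdgeLT n => (G.pathGraph n).r p = w := by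
      ext p; simp
    rw [h2, h1]
    split_ifs
    · exact isCompactOperator_matrixUnit _ _
    · exact isCompactOperator_zero

/-! ## Generators of `A(n)` and the ideal `K_E` -/

section ShiftAlgebra

variable {n : ℕ} (hn : 1 ≤ n)

include hn

theorem Path.remLT_rem (w : G.Path) : Path.remLT n hn (w.rem n) = Path.remLT n hn w :=
  Path.remLT_val n hn (Path.remLT n hn w)

/-- T_p is one component of a weighted shift with weights 0 and 1: the weight is the indicator of
the paths e w with (e, w(n)) = p, which depends on w only through w(n) and so is periodic. -/
theorem opT_mem_shiftAlgebra (p : G.EdgeLT n) : G.opT n p ∈ G.shiftAlgebra n := by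
  classical
  refine subset_cstarGenerated _ ⟨fun e => if e = p.1.1 then G.opT n p else 0,
    fun u => if ∃ (w : G.Path) (h : G.s p.1.1 = w.rng),
      u = w.cons p.1.1 h ∧ p.1.2 = Path.remLT n hn w then 1 else 0, ?_, ?_, p.1.1, by simp⟩
  · intro e w
    have key : ∀ h : G.s e = w.rng, (∃ (w' : G.Path) (h' : G.s p.1.1 = w'.rng),
        w.cons e h = w'.cons p.1.1 h' ∧ p.1.2 = Path.remLT n hn w') ↔
        e = p.1.1 ∧ p.1.2 = Path.remLT n hn w := by
      intro h
      constructor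
      · rintro ⟨w', h', heq, hp⟩
        obtain ⟨h1, rfl⟩ := Path.cons_inj heq
        exact ⟨h1, hp⟩
      · rintro ⟨rfl, hp⟩
        exact ⟨w, h, rfl, hp⟩
    simp only [key]
    by_cases he : e = p.1.1
    · subst he
      by_cases hp : p.1.2 = Path.remLT n hn w
      · have h1 := opT_ell2Basis_of_eq hn p w hp
        simp only [if_true, hp, and_self, one_smul, dif_pos (rng_eq_of_snd_eq_remLT hp)]
        exact h1
      · have h1 := opT_ell2Basis_of_ne hn p w hp
        simp only [if_true, hp, and_false, if_false, zero_smul, dite_eq_ite, ite_self]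
        exact h1
    · simp [he]
  · intro e w h
    refine if_congr ?_ rfl rfl
    constructor
    · rintro ⟨w', h', heq, hp⟩
      obtain ⟨rfl, rfl⟩ := Path.cons_inj heq
      exact ⟨w.rem n, h, rfl, by rw [Path.remLT_rem, hp]⟩
    · rintro ⟨w', h', heq, hp⟩
      obtain ⟨rfl, rfl⟩ := Path.cons_inj heq
      exact ⟨w, h, rfl, by rw [hp, Path.remLT_rem]⟩

/-- Periodicity says that T_e acts by the constant weight λ(e v) on the basis vectors ξ_w with w(n)
= v. -/
theorem weightedShift_eq_sum [Fintype (G.EdgeLT n)] {T : E → G.FockOp} {lam : G.Path → ℂ}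
    (hT : G.IsWeightedShift T lam) (hlam : G.IsPeriodic n lam) (e : E) :
    ∃ c : G.EdgeLT n → ℂ, T e = ∑ p, c p • G.opT n p := by
  classical
  refine ⟨fun p => if p.1.1 = e then lam (p.1.2.1.cons p.1.1 p.2) else 0, ell2_ext fun w => ?_⟩
  have h1 := hT e w
  refine h1.trans ?_
  change _ = (∑ p : G.EdgeLT n, (if p.1.1 = e then lam (p.1.2.1.cons p.1.1 p.2) else 0) •
    G.opT n p) (ell2Basis w)
  rw [sum_apply]
  by_cases he : G.s e = w.rng
  · rw [dif_pos he, Finset.sum_eq_single ⟨(e, Path.remLT n hn w), he⟩]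
    · rw [if_pos rfl, smul_apply, opT_ell2Basis_of_eq hn _ w rfl, hlam e w he]
      rfl
    · intro p _ hp
      split_ifs with hpe
      · rw [smul_apply, opT_ell2Basis_of_ne hn p w fun hc => hp (Subtype.ext (Prod.ext hpe hc)),
          smul_zero]
      · rw [zero_smul, zero_apply]
    · simp
  · rw [dif_neg he, Finset.sum_eq_zero]
    intro p _
    split_ifs with hpe
    · rw [smul_apply, opT_ell2Basis_of_ne hn p w fun hc =>
        he (hpe ▸ rng_eq_of_snd_eq_remLT hc), smul_zero]
    · rw [zero_smul, zero_apply]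

theorem shiftAlgebra_le [Finite V] [Finite E] {D : NonUnitalStarSubalgebra ℂ G.FockOp}
    (hD : IsClosed (D : Set G.FockOp)) (h : ∀ p, G.opT n p ∈ D) : G.shiftAlgebra n ≤ D := by
  have := Fintype.ofFinite (G.EdgeLT n)
  refine cstarGenerated_le hD ?_
  rintro _ ⟨T, lam, hT, hlam, e, rfl⟩
  obtain ⟨c, hc⟩ := weightedShift_eq_sum hn hT hlam e
  rw [hc]
  exact sum_mem fun p _ => SMulMemClass.smul_mem _ (h p)

theorem exists_star_opT_mul_opT_eq_opQ (hG : G.NoSinks) (w : G.PathLT n) :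
    ∃ p : G.EdgeLT n, p.1.2 = w ∧ star (G.opT n p) * G.opT n p = G.opQ n w := by
  obtain ⟨e, he⟩ := hG w.1.rng
  exact ⟨⟨(e, w), he⟩, rfl, star_opT_mul_opT_self hn _⟩

variable [Finite V] [Finite E]

/-- This is the defect of the range relation at the vertex x; its Q-term lies in A(n) as T_p^* T_p
for an edge p leaving x. -/
theorem matrixUnit_vertex_mem (hG : G.NoSinks) (x : V) :
    matrixUnit (Path.vertex G x) (Path.vertex G x) ∈ G.shiftAlgebra n := by
  classical
  have := Fintype.ofFinite (G.EdgeLT n)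
  have h := opQ_sub_sum_opT_mul_star hn ⟨Path.vertex G x, hn⟩
  rw [if_pos (Path.length_vertex x)] at h
  rw [← h]
  obtain ⟨p, -, hp⟩ := exists_star_opT_mul_opT_eq_opQ hn hG ⟨Path.vertex G x, hn⟩
  rw [← hp]
  have hmem := fun p => opT_mem_shiftAlgebra (G := G) hn p
  exact sub_mem (mul_mem (star_mem (hmem p)) (hmem p))
    (sum_mem fun p _ => mul_mem (hmem p) (star_mem (hmem p)))

/-- Start from the projection at the source of u and apply the T_p along the edges of u. -/
theorem matrixUnit_src_mem (hG : G.NoSinks) (L : ℕ) :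
    ∀ u : G.Path, u.length = L → matrixUnit u (Path.vertex G u.src) ∈ G.shiftAlgebra n := by
  induction L with
  | zero =>
    intro u hu
    rw [Path.eq_vertex_of_length_eq_zero hu]
    exact matrixUnit_vertex_mem hn hG _
  | succ L ih =>
    intro u hu
    obtain ⟨e, v, he, rfl⟩ := Path.exists_eq_cons hu
    let p : G.EdgeLT n := ⟨(e, Path.remLT n hn v), he⟩
    rw [src_cons, ← clm_mul_matrixUnit (opT_ell2Basis_of_eq hn p v rfl)]
    exact mul_mem (opT_mem_shiftAlgebra hn p) (ih v (Nat.succ_injective hu))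

theorem matrixUnit_mem (hG : G.NoSinks) {u v : G.Path} (huv : u.src = v.src) :
    matrixUnit u v ∈ G.shiftAlgebra n := by
  have h1 := matrixUnit_src_mem hn hG _ u rfl
  have h2 := star_mem (matrixUnit_src_mem hn hG _ v rfl)
  rw [star_matrixUnit, ← huv] at h2
  have h3 : matrixUnit u (Path.vertex G u.src) * matrixUnit (Path.vertex G u.src) v =
      matrixUnit u v := by
    refine clm_mul_matrixUnit ?_
    rw [matrixUnit_apply, ell2Basis_apply, if_pos rfl, one_smul]
  rw [← h3]
  exact mul_mem h1 h2

omit [Finite E] hn in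
theorem isCompactOperator_of_mem_compactsE {T : G.FockOp} (hT : T ∈ G.compactsE) :
    IsCompactOperator T := by
  have := Fintype.ofFinite V
  obtain ⟨K, hK, rfl⟩ := hT
  rw [finsum_eq_sum_of_fintype]
  exact isCompactOperator_finset_sum _ _ fun x _ => ((hK x).clm_comp (G.opR x)).comp_clm (G.opR x)

omit [Finite V] [Finite E] hn in
theorem opR_apply (x : V) (y : G.FockSpace) (u : G.Path) [Decidable (u.src = x)] :
    G.opR x y u = if u.src = x then y u else 0 := by
  rw [opR, partialShift_apply, PEquiv.ofSet_symm]
  by_cases h : u.src = x <;> simp [PEquiv.ofSet, h]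

/-- Finite corners of T converge to T in norm. Their entries between paths with different sources
vanish, and the other matrix units are in A(n). -/
theorem compactsE_subset_shiftAlgebra (hG : G.NoSinks) :
    G.compactsE ⊆ (G.shiftAlgebra n : Set G.FockOp) := by
  classical
  intro T hT
  have hlim := tendsto_finProj_mul_mul_finProj (isCompactOperator_of_mem_compactsE hT)
  refine (isClosed_cstarGenerated _).mem_of_tendsto hlim (Eventually.of_forall fun F => ?_)
  rw [finProj_mul_mul_finProj]
  refine sum_mem fun u _ => sum_mem fun v _ => ?_
  by_cases huv : u.src = v.src
  · exact SMulMemClass.smul_mem _ (matrixUnit_mem hn hG huv)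
  · have h0 : T (ell2Basis v) u = 0 := by
      have := Fintype.ofFinite V
      obtain ⟨K, hK, rfl⟩ := hT
      rw [finsum_eq_sum_of_fintype, sum_apply, lp.coeFn_sum, Finset.sum_apply]
      refine Finset.sum_eq_zero fun x _ => ?_
      rw [mul_apply_eq_comp, mul_apply_eq_comp, opR_apply]
      split_ifs with hx
      · rw [← xi_eq_ell2Basis, opR_xi, if_neg fun h => huv (hx.trans h.symm), map_zero]
        rfl
      · rfl
    rw [h0, zero_smul]
    exact zero_mem _

-- Since a commutes with the projections R_x, which sum to 1, it equals ∑ R_x a R_x.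
omit [Finite E] hn in
theorem mem_compactsE_of_isCompactOperator {a : G.FockOp} (ha : a ∈ G.shiftAlgebra n)
    (hK : IsCompactOperator a) : a ∈ G.compactsE := by
  classical
  have := Fintype.ofFinite V
  refine ⟨fun _ => a, fun _ => hK, ?_⟩
  rw [finsum_eq_sum_of_fintype]
  have h1 : ∑ x, G.opR x = 1 := by
    refine ell2_ext fun w => ?_
    change (∑ x, G.opR x) (G.xi w) = G.xi w
    rw [sum_apply]
    simp [opR_xi]
  have h2 : ∀ x, G.opR x * G.opR x = G.opR x := fun x =>
    (isStarProjection_partialShift_ofSet _).isIdempotentElem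
  simp only [G.opR_mul_comm n ha, mul_assoc, h2]
  rw [← Finset.mul_sum, h1, mul_one]

theorem finProj_mem (hG : G.NoSinks) (F : Finset G.Path) : finProj F ∈ G.shiftAlgebra n := by
  rw [finProj_eq_sum]
  exact sum_mem fun u _ => matrixUnit_mem hn hG rfl

/-- The image of `A(n)` in the Calkin algebra is closed. -/
theorem isClosed_image_shiftAlgebra (hG : G.NoSinks) :
    IsClosed (G.calkinMk '' (G.shiftAlgebra n : Set G.FockOp)) := by
  let K : AddSubgroup G.Calkin :=
    ((G.shiftAlgebra n).toAddSubgroup).map (G.calkinHom : G.FockOp →+ G.Calkin)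
  have hKeq : (K : Set G.Calkin) = G.calkinMk '' (G.shiftAlgebra n : Set G.FockOp) := rfl
  have : CompleteSpace (G.shiftAlgebra n) := (isClosed_cstarGenerated _).completeSpace_coe
  let f : NormedAddGroupHom (G.shiftAlgebra n) G.Calkin :=
    { toFun := fun a => G.calkinHom a
      map_add' := fun a b => map_add G.calkinHom _ _
      bound' := ⟨1, fun a => by rw [one_mul]; exact norm_calkinHom_le _⟩ }
  -- For a nonzero class, (1 - p)a is a lift in A(n) with norm below ‖q(a)‖ + ε; the choice ε =
  -- ‖q(a)‖ gives the constant 2. Controlled lifting then passes to the closure.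
  have hsurj : f.SurjectiveOnWith K 2 := by
    rintro _ ⟨a, ha, rfl⟩
    by_cases h0 : G.calkinHom a = 0
    · refine ⟨0, (map_zero f).trans h0.symm, ?_⟩
      rw [norm_zero]
      positivity
    · obtain ⟨F, hF⟩ := compactIdeal.exists_norm_sub_finProj_mul_lt a (norm_pos_iff.2 h0)
      refine ⟨⟨a - finProj F * a, sub_mem ha (mul_mem (finProj_mem hn hG F) ha)⟩, ?_, ?_⟩
      · refine compactIdeal.cls_eq_cls_iff.2 ?_
        rw [sub_sub_cancel_left]
        exact ((isCompactOperator_finProj F).comp_clm a).neg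
      · refine hF.le.trans_eq ?_
        rw [two_mul]
        rfl
  have hcl := controlled_closure_of_complete two_pos one_pos hsurj
  rw [← hKeq]
  refine isClosed_of_closure_subset fun x hx => ?_
  obtain ⟨a, rfl, -⟩ := hcl x hx
  exact ⟨a, a.2, rfl⟩

end ShiftAlgebra

/-! ## Generation of graph algebras by their canonical families -/

section GraphAlgebra

variable [Finite E] (F : DirectedGraph V E)

/-- Generation is defined inside the product of all representations; the ⋆-polynomials there are
images of the ⋆-polynomials formed inside O(F). -/
theorem dense_adjoin_graphAlgebra : Dense
    (NonUnitalStarAlgebra.adjoin ℂ (Set.range F.genP ∪ Set.range F.genS) : Set F.graphAlgebra) := by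
  intro x
  rw [Topology.IsInducing.subtypeVal.closure_eq_preimage_closure_image]
  refine closure_mono ?_ x.2
  intro y hy
  refine NonUnitalStarAlgebra.adjoin_induction (R := ℂ) (p := fun y _ => y ∈ Subtype.val ''
    (NonUnitalStarAlgebra.adjoin ℂ (Set.range F.genP ∪ Set.range F.genS) : Set F.graphAlgebra))
    ?_ ?_ ?_ ?_ ?_ ?_ hy
  · rintro _ (⟨w, rfl⟩ | ⟨e, rfl⟩)
    · exact ⟨F.genP w, NonUnitalStarAlgebra.subset_adjoin ℂ _ (Or.inl ⟨w, rfl⟩), rfl⟩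
    · exact ⟨F.genS e, NonUnitalStarAlgebra.subset_adjoin ℂ _ (Or.inr ⟨e, rfl⟩), rfl⟩
  · rintro _ _ - - ⟨a, ha, rfl⟩ ⟨b, hb, rfl⟩
    exact ⟨a + b, add_mem ha hb, rfl⟩
  · exact ⟨0, zero_mem _, rfl⟩
  · rintro _ _ - - ⟨a, ha, rfl⟩ ⟨b, hb, rfl⟩
    exact ⟨a * b, mul_mem ha hb, rfl⟩
  · rintro c _ - ⟨a, ha, rfl⟩
    exact ⟨c • a, SMulMemClass.smul_mem c ha, rfl⟩
  · rintro _ - ⟨a, ha, rfl⟩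
    exact ⟨star a, star_mem ha, rfl⟩

variable {F}

theorem graphAlgebra_induction {p : F.graphAlgebra → Prop} (hclosed : IsClosed {x | p x})
    (h : ∀ x ∈ NonUnitalStarAlgebra.adjoin ℂ (Set.range F.genP ∪ Set.range F.genS), p x)
    (x : F.graphAlgebra) : p x := by
  have h1 := closure_minimal h hclosed
  rw [F.dense_adjoin_graphAlgebra.closure_eq] at h1
  exact h1 (Set.mem_univ x)

theorem continuous_starHom {A B : Type*} [NonUnitalCStarAlgebra A] [NonUnitalCStarAlgebra B]
    (π : A →⋆ₙₐ[ℂ] B) : Continuous π :=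
  AddMonoidHomClass.continuous_of_bound π 1 fun a => by
    rw [one_mul]; exact NonUnitalStarAlgHom.norm_apply_le π a

theorem graphAlgebra_hom_ext {B : Type*} [NonUnitalCStarAlgebra B]
    {π π' : F.graphAlgebra →⋆ₙₐ[ℂ] B}
    (hP : ∀ w, π (F.genP w) = π' (F.genP w)) (hS : ∀ e, π (F.genS e) = π' (F.genS e)) :
    π = π' := by
  refine NonUnitalStarAlgHom.ext fun x => ?_
  refine graphAlgebra_induction (p := fun x => π x = π' x)
    (isClosed_eq (continuous_starHom π) (continuous_starHom π')) ?_ x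
  intro x hx
  induction hx using NonUnitalStarAlgebra.adjoin_induction with
  | mem x hx =>
    obtain ⟨w, rfl⟩ | ⟨e, rfl⟩ := hx
    · exact hP w
    · exact hS e
  | add x y _ _ h1 h2 => rw [map_add, map_add, h1, h2]
  | zero => rw [map_zero, map_zero]
  | mul x y _ _ h1 h2 => rw [map_mul, map_mul, h1, h2]
  | smul c x _ h1 => rw [map_smul, map_smul, h1]
  | star x _ h1 => rw [map_star, map_star, h1]

end GraphAlgebra

/-! ## The representation of `O(E(n))` in the Calkin algebra -/

section Representation

variable [Finite V] [Finite E] {n : ℕ} (hn : 1 ≤ n)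
  {π : (G.pathGraph n).graphAlgebra →⋆ₙₐ[ℂ] G.Calkin}
  (hπ : ∀ p, π ((G.pathGraph n).genS p) = G.calkinMk (G.opT n p))

include hn hπ

/-- T is the same ⋆-polynomial in the T_p as x is in the s_p; each p_w enters as s_p^* s_p for an
edge p with source w. T depends on the chosen expression for x, so only existence is claimed. -/
theorem exists_lift_of_mem_adjoin (hsource : G.NoSources) (hsink : G.NoSinks)
    [Fintype (G.PathLT n)] {x : (G.pathGraph n).graphAlgebra}
    (hx : x ∈ NonUnitalStarAlgebra.adjoin ℂ
      (Set.range (G.pathGraph n).genP ∪ Set.range (G.pathGraph n).genS)) :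
    ∃ T ∈ G.shiftAlgebra n, CompressesTo hn (G.pathGraph n).genP (G.pathGraph n).genS T x ∧
      π x = G.calkinHom T := by
  have hck := (G.pathGraph n).isCKFamily_graphAlgebra
  have hS : ∀ p, G.opT n p ∈ G.shiftAlgebra n ∧
      CompressesTo hn (G.pathGraph n).genP (G.pathGraph n).genS (G.opT n p)
        ((G.pathGraph n).genS p) ∧ π ((G.pathGraph n).genS p) = G.calkinHom (G.opT n p) :=
    fun p => ⟨opT_mem_shiftAlgebra hn p, CompressesTo.of_opT hck hsource p, hπ p⟩
  induction hx using NonUnitalStarAlgebra.adjoin_induction with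
  | mem x hx =>
    obtain ⟨w, rfl⟩ | ⟨p, rfl⟩ := hx
    · obtain ⟨p, rfl, -⟩ := exists_star_opT_mul_opT_eq_opQ hn hsink w
      obtain ⟨h1, h2, h3⟩ := hS p
      rw [show (G.pathGraph n).genP p.1.2 =
        star ((G.pathGraph n).genS p) * (G.pathGraph n).genS p from (hck.star_mul_self p).symm]
      exact ⟨_, mul_mem (star_mem h1) h1, h2.star.mul h2, by
        rw [map_mul, map_mul, map_star, map_star, h3]⟩
    · exact ⟨_, hS p⟩
  | add x y _ _ h1 h2 =>
    obtain ⟨T, hT1, hT2, hT3⟩ := h1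
    obtain ⟨T', hT1', hT2', hT3'⟩ := h2
    exact ⟨_, add_mem hT1 hT1', hT2.add hT2', by rw [map_add, map_add, hT3, hT3']⟩
  | zero => exact ⟨0, zero_mem _, CompressesTo.zero, by rw [map_zero, map_zero]⟩
  | mul x y _ _ h1 h2 =>
    obtain ⟨T, hT1, hT2, hT3⟩ := h1
    obtain ⟨T', hT1', hT2', hT3'⟩ := h2
    exact ⟨_, mul_mem hT1 hT1', hT2.mul hT2', by rw [map_mul, map_mul, hT3, hT3']⟩
  | smul c x _ h1 =>
    obtain ⟨T, hT1, hT2, hT3⟩ := h1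
    exact ⟨_, SMulMemClass.smul_mem c hT1, hT2.smul c, by rw [map_smul, map_smul, hT3]⟩
  | star x _ h1 =>
    obtain ⟨T, hT1, hT2, hT3⟩ := h1
    exact ⟨_, star_mem hT1, hT2.star, by rw [map_star, map_star, hT3]⟩

/-- The compression estimate is applied to the universal family in O(E(n)) itself, then extended
from ⋆-polynomials by continuity. -/
theorem norm_le_norm_calkin_rep (hsource : G.NoSources) (hsink : G.NoSinks)
    (x : (G.pathGraph n).graphAlgebra) : ‖x‖ ≤ ‖π x‖ := by
  have := Fintype.ofFinite (G.PathLT n)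
  refine graphAlgebra_induction (p := fun x => ‖x‖ ≤ ‖π x‖)
    (isClosed_le continuous_norm (continuous_starHom π).norm) (fun x hx => ?_) x
  obtain ⟨T, -, hT, hx⟩ := exists_lift_of_mem_adjoin hn hπ hsource hsink hx
  rw [hx]
  exact hT.norm_le (G.pathGraph n).isCKFamily_graphAlgebra hsource

/-- One inclusion uses that q(A(n)) is closed. For the other, π is bounded below, so its range is
closed and the preimage of the range under q is a closed ⋆-subalgebra containing all T_p. -/
theorem range_calkin_rep (hsource : G.NoSources) (hsink : G.NoSinks) :
    Set.range π = G.calkinMk '' (G.shiftAlgebra n : Set G.FockOp) := by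
  have := Fintype.ofFinite (G.PathLT n)
  refine Set.Subset.antisymm ?_ ?_
  · rintro _ ⟨x, rfl⟩
    refine graphAlgebra_induction
      (p := fun x => π x ∈ G.calkinMk '' (G.shiftAlgebra n : Set G.FockOp))
      ((isClosed_image_shiftAlgebra hn hsink).preimage (continuous_starHom π)) (fun x hx => ?_) x
    obtain ⟨T, hT, -, hx⟩ := exists_lift_of_mem_adjoin hn hπ hsource hsink hx
    exact ⟨T, hT, hx.symm⟩
  · have hanti : AntilipschitzWith 1 π := AddMonoidHomClass.antilipschitz_of_bound π fun x => by
      rw [NNReal.coe_one, one_mul]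
      exact norm_le_norm_calkin_rep hn hπ hsource hsink x
    have huc : UniformContinuous π := (AddMonoidHomClass.lipschitz_of_bound π 1 fun x => by
      rw [one_mul]; exact NonUnitalStarAlgHom.norm_apply_le π x).uniformContinuous
    have hclosed : IsClosed (Set.range π) := hanti.isClosed_range huc
    let D : NonUnitalStarSubalgebra ℂ G.FockOp :=
      (NonUnitalStarAlgHom.range π).comap G.calkinHom
    have hle : G.shiftAlgebra n ≤ D := by
      refine shiftAlgebra_le hn (hclosed.preimage continuous_calkinHom) fun p => ?_
      exact ⟨_, hπ p⟩
    rintro _ ⟨T, hT, rfl⟩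
    exact hle hT

end Representation

theorem cls_eq_cls_iff_calkinMk [Finite V] {n : ℕ} (a b : G.shiftAlgebra n) :
    (G.idealE n).cls a = (G.idealE n).cls b ↔ G.calkinMk a = G.calkinMk b := by
  rw [StarIdeal.cls_eq_mk, compactIdeal.cls_eq_cls_iff]
  exact ⟨fun h => isCompactOperator_of_mem_compactsE h,
    fun h => mem_compactsE_of_isCompactOperator (a - b).2 h⟩

/-- An injective ⋆-homomorphism onto the image of `A(n)` in the Calkin algebra identifies its domain
with `B(n)`. -/
theorem exists_equiv_shiftQuotient [Finite V] {n : ℕ} {A : Type*} [NonUnitalCStarAlgebra A]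
    {π : A →⋆ₙₐ[ℂ] G.Calkin} (hinj : Function.Injective π)
    (hrange : Set.range π = G.calkinMk '' (G.shiftAlgebra n : Set G.FockOp)) :
    ∃ φ : A ≃⋆ₐ[ℂ] G.shiftQuotient n,
      ∀ (x : A) (a : G.shiftAlgebra n), φ x = (G.idealE n).cls a ↔ π x = G.calkinMk a := by
  have hex : ∀ x, ∃ a : G.shiftAlgebra n, G.calkinMk a = π x := by
    intro x
    obtain ⟨a, ha, hax⟩ := hrange.subset ⟨x, rfl⟩
    exact ⟨⟨a, ha⟩, hax⟩
  choose σ hσ using hex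
  -- The class of the chosen lift σ x does not depend on the choice, so each algebraic identity may
  -- be checked on any convenient lift.
  have hiff : ∀ (x : A) (a : G.shiftAlgebra n),
      (G.idealE n).cls (σ x) = (G.idealE n).cls a ↔ π x = G.calkinMk a := by
    intro x a
    rw [cls_eq_cls_iff_calkinMk, hσ]
  have hbij : Function.Bijective fun x => (G.idealE n).cls (σ x) := by
    constructor
    · intro x y hxy
      exact hinj (((hiff x (σ y)).1 hxy).trans (hσ y))
    · intro z
      obtain ⟨a, rfl⟩ := (G.idealE n).cls_surjective z
      obtain ⟨x, hx⟩ := hrange.superset ⟨a, a.2, rfl⟩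
      exact ⟨x, (hiff x a).2 hx⟩
  refine ⟨{ Equiv.ofBijective _ hbij with
    map_mul' := fun x y => ?_
    map_add' := fun x y => ?_
    map_star' := fun x => ?_
    map_smul' := fun c x => ?_ }, hiff⟩
  · refine (hiff _ (σ x * σ y)).2 ?_
    rw [map_mul, ← hσ, ← hσ]
    rfl
  · refine (hiff _ (σ x + σ y)).2 ?_
    rw [map_add, ← hσ, ← hσ]
    rfl
  · refine (hiff _ (star (σ x))).2 ?_
    rw [map_star, ← hσ]
    rfl
  · refine (hiff _ (c • σ x)).2 ?_
    rw [map_smul, ← hσ]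
    rfl

end DirectedGraph

end

theorem mainTheorem2 {V E : Type u} [Finite V] [Finite E] (G : DirectedGraph V E)
    (hsource : G.NoSources) (hsink : G.NoSinks) (n : ℕ) (hn : 1 ≤ n) :
    -- the images of `Q_w`, `T_{(e,w)}` in the Calkin algebra are a Cuntz-Krieger `E(n)`-family
    (G.pathGraph n).IsCKFamily
      (fun w => G.calkinMk (G.opQ n w)) (fun p => G.calkinMk (G.opT n p)) ∧
    -- `K_E` is contained in `A(n)`
    G.compactsE ⊆ (G.shiftAlgebra n : Set G.FockOp) ∧
    -- there is exactly one ⋆-homomorphism `π` from `O(E(n))` that extends this family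
    ∃ π : (G.pathGraph n).graphAlgebra →⋆ₙₐ[ℂ] G.Calkin,
      ((∀ w, π ((G.pathGraph n).genP w) = G.calkinMk (G.opQ n w)) ∧
        (∀ p, π ((G.pathGraph n).genS p) = G.calkinMk (G.opT n p))) ∧
      (∀ π' : (G.pathGraph n).graphAlgebra →⋆ₙₐ[ℂ] G.Calkin,
        (∀ w, π' ((G.pathGraph n).genP w) = G.calkinMk (G.opQ n w)) →
        (∀ p, π' ((G.pathGraph n).genS p) = G.calkinMk (G.opT n p)) → π' = π) ∧
      -- it is injective with range the image of `A(n)`, and under the identification of the class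
      -- of `a ∈ A(n)` modulo `K_E` with the class of `a` modulo the compact operators it is a
      -- ⋆-isomorphism onto `B(n) = A(n) / K_E`
      Function.Injective π ∧
      Set.range π = G.calkinMk '' (G.shiftAlgebra n : Set G.FockOp) ∧
      ∃ φ : (G.pathGraph n).graphAlgebra ≃⋆ₐ[ℂ] G.shiftQuotient n,
        ∀ (x : (G.pathGraph n).graphAlgebra) (a : G.shiftAlgebra n),
          φ x = (G.idealE n).cls a ↔ π x = G.calkinMk a := by
  refine ⟨DirectedGraph.isCKFamily_calkin hn,
    DirectedGraph.compactsE_subset_shiftAlgebra hn hsink, ?_⟩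
  obtain ⟨π, hP, hS⟩ := (G.pathGraph n).graphAlgebra_universal
    (DirectedGraph.isCKFamily_calkin (G := G) hn)
  have hinj : Function.Injective π := by
    refine (injective_iff_map_eq_zero π).2 fun x hx => ?_
    have h := DirectedGraph.norm_le_norm_calkin_rep hn hS hsource hsink x
    rwa [hx, norm_zero, norm_le_zero_iff] at h
  have hrange := DirectedGraph.range_calkin_rep hn hS hsource hsink
  refine ⟨π, ⟨hP, hS⟩, fun π' hP' hS' => ?_, hinj, hrange,
    DirectedGraph.exists_equiv_shiftQuotient hinj hrange⟩
  exact DirectedGraph.graphAlgebra_hom_ext (fun w => (hP' w).trans (hP w).symm)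
    fun p => (hS' p).trans (hS p).symm
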